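/- **Theorem (power of the oracle semi-supervised two-sample test).** For every $k\in\mathbb N$ let $P_{XV}$ and $P_{YW}$ be probability laws on $\mathcal X\times\mathcal V$ (they may depend on $k$), and let $n_1,n_2,m_1,m_2\ge 0$ be integers depending on $k$ with $n=\min(n_1,n_2)\to\infty$ as $k\to\infty$; $m_1,m_2$ are otherwise unrestricted. One observes labeled data $(X_i,V_i)_{i\le n_1}$ i.i.d. from $P_{XV}$ and $(Y_i,W_i)_{i\le n_2}$ i.i.d. from $P_{YW}$, and unlabeled data $(V_i)_{n_1<i\le n_1+m_1}$ i.i.d. from $P_V$ and $(W_i)_{n_2<i\le n_2+m_2}$ i.i.d. from $P_W$, all mutually independent. Let $f:\mathcal X\to\mathbb R$ be a possibly random (jointly measurable) function, which may depend on $k$, independent of all the data. All expectations and variances of functions of $f$ in the definitions below are conditional on $f$. Put $g_X(v)=\mathbb E[f(X)\mid V=v]$ and $$\sigma_{1,X,f}^2=\mathbb E[\mathrm{Var}\{f(X)\mid V\}],\quad \sigma_{2,X,f}^2=\mathrm{Var}[\mathbb E\{f(X)\mid V\}],\quad \sigma_{X,f}^2=\frac{\sigma_{1,X,f}^2}{n_1}+\frac{\sigma_{2,X,f}^2}{n_1+m_1},$$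 $$\bar g_X=\frac1{n_1+m_1}\sum_{i=1}^{n_1+m_1}g_X(V_i),\qquad \widehat\mu_{X,f}=\frac1{n_1}\sum_{i=1}^{n_1}\{f(X_i)-g_X(V_i)\}+\bar g_X,$$ $$\widehat\sigma_{X,f}^2=\frac1{n_1^2}\sum_{i=1}^{n_1}\{f(X_i)-g_X(V_i)\}^2+\frac1{(n_1+m_1)^2}\sum_{i=1}^{n_1+m_1}\{g_X(V_i)-\bar g_X\}^2,$$ and define the corresponding quantities for $(Y,W)$ analogously, with $n_2,m_2$. Let $\Phi$ be the distribution function of $N(0,1)$ and $z_p=\Phi^{-1}(p)$. For $\alpha\in(0,1)$ the oracle test rejects when $$T_{\mathrm{oracle}}=\frac{\widehat\mu_{X,f}-\widehat\mu_{Y,f}}{\sqrt{\widehat\sigma_{X,f}^2+\widehat\sigma_{Y,f}^2}}>z_{1-\alpha}.$$ Assume that for some fixed $\delta>0$ $$\frac{\mathbb E[|f(X)-\mathbb E f(X)|^{2+\delta}]}{\sigma_{1,X,f}^{2+\delta}\wedge\sigma_{2,X,f}^{2+\delta}}=o_P\bigl(n_1^{\delta/2}\bigr),\qquad \frac{\mathbb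 E[|f(Y)-\mathbb E f(Y)|^{2+\delta}]}{\sigma_{1,Y,f}^{2+\delta}\wedge\sigma_{2,Y,f}^{2+\delta}}=o_P\bigl(n_2^{\delta/2}\bigr)$$ as $k\to\infty$, where a ratio counts as $+\infty$ if its numerator is infinite or its denominator is zero. Then: 1. Unconditionally on $f$, $$\mathbb P(T_{\mathrm{oracle}}>z_{1-\alpha})-\mathbb E\Bigl[\Phi\Bigl(z_\alpha+\frac{\mathbb E[f(X)\mid f]-\mathbb E[f(Y)\mid f]}{\sqrt{\sigma_{X,f}^2+\sigma_{Y,f}^2}}\Bigr)\Bigr]\to0,$$ where the outer expectation is over $f$ (and is not needed if $f$ is non-random). 2. If $P_X=P_Y$ for all $k$, then $\mathbb P(T_{\mathrm{oracle}}>z_{1-\alpha})\to\alpha$. 3. If $\mathbb P\bigl(\mathbb E[f(X)\mid f]<\mathbb E[f(Y)\mid f]\bigr)\to0$, then the asymptotic power of the oracle test is not below that of the two-sample $t$-test, $\liminf_k\{\mathbb P(T_{\mathrm{oracle}}>z_{1-\alpha})-\mathbb P(T_0>c_k)\}\ge0$, both when $T_0$ is the two-sample $t$-statistic for $f(X_1),\dots,f(X_{n_1})$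 and $f(Y_1),\dots,f(Y_{n_2})$ with separate unbiased sample variances and $c_k$ is any sequence with $c_k\to z_{1-\alpha}$ (for example normal or Student quantiles), and when $T_0$ is $T_{\mathrm{oracle}}$ computed with $m_1=m_2=0$ and $c_k=z_{1-\alpha}$. -/

import Mathlib

open MeasureTheory ProbabilityTheory Filter Topology
open scoped ENNReal

noncomputable section

namespace SemiSupervised

variable {𝒳 𝒱 : Type*} [MeasurableSpace 𝒳] [MeasurableSpace 𝒱]

/-! ## Standard normal distribution -/

/-- Distribution function `Φ` of `N(0,1)`. -/
def normalCDF (x : ℝ) : ℝ := cdf (gaussianReal 0 1) x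

/-- The `p`-quantile `z_p` of `N(0,1)`. -/
def normalQuantile (p : ℝ) : ℝ := sInf {x : ℝ | p ≤ normalCDF x}

/-! ## Population quantities of a feature `f` under the law `P` of a labeled pair `(X, V)`

The coordinate `Prod.fst` plays the role of `X` and `Prod.snd` that of `V`. -/

/-- The σ-algebra on `𝒳 × 𝒱` generated by the covariate. -/
abbrev covariateAlgebra (𝒳 𝒱 : Type*) [MeasurableSpace 𝒱] : MeasurableSpace (𝒳 × 𝒱) :=
  MeasurableSpace.comap Prod.snd inferInstance

/-- `E[f(X)]`. -/
def popMean (P : Measure (𝒳 × 𝒱)) (f : 𝒳 → ℝ) : ℝ := ∫ p, f p.1 ∂P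

/-- `g` is a version of the regression function `v ↦ E[f(X) | V = v]`. -/
def IsCondMean (P : Measure (𝒳 × 𝒱)) (f : 𝒳 → ℝ) (g : 𝒱 → ℝ) : Prop :=
  (fun p : 𝒳 × 𝒱 => g p.2) =ᵐ[P] condExp (covariateAlgebra 𝒳 𝒱) P (fun p => f p.1)

/-- `σ₁² = E[Var{f(X) | V}]`. -/
def sigma1Sq (P : Measure (𝒳 × 𝒱)) (f : 𝒳 → ℝ) : ℝ :=
  ∫ p, condVar (covariateAlgebra 𝒳 𝒱) (fun p : 𝒳 × 𝒱 => f p.1) P p ∂P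

/-- `σ₂² = Var[E{f(X) | V}]`. -/
def sigma2Sq (P : Measure (𝒳 × 𝒱)) (f : 𝒳 → ℝ) : ℝ :=
  variance (condExp (covariateAlgebra 𝒳 𝒱) P (fun p => f p.1)) P

/-- `σ² = σ₁² / n + σ₂² / (n + m)`, with `n` labeled and `m` unlabeled observations. -/
def sigmaSq (n m : ℕ) (P : Measure (𝒳 × 𝒱)) (f : 𝒳 → ℝ) : ℝ :=
  sigma1Sq P f / n + sigma2Sq P f / (n + m)

/-- `(E[f(X)] - E[f(Y)]) / √(σ²_X + σ²_Y)`. -/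
def standardizedShift (n₁ m₁ n₂ m₂ : ℕ) (P Q : Measure (𝒳 × 𝒱)) (f : 𝒳 → ℝ) : ℝ :=
  (popMean P f - popMean Q f) / √(sigmaSq n₁ m₁ P f + sigmaSq n₂ m₂ Q f)

/-- `E|f(X) - E f(X)|^(2+δ) / (σ₁^(2+δ) ∧ σ₂^(2+δ))`. It is `∞` when the moment is infinite
or the denominator vanishes. -/
def momentRatio (δ : ℝ) (P : Measure (𝒳 × 𝒱)) (f : 𝒳 → ℝ) : ℝ≥0∞ :=
  let d : ℝ := min (√(sigma1Sq P f) ^ (2 + δ)) (√(sigma2Sq P f) ^ (2 + δ))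
  if 0 < d then (∫⁻ p, ENNReal.ofReal (|f p.1 - popMean P f| ^ (2 + δ)) ∂P) / ENNReal.ofReal d
  else ∞

/-- `R k = o_P(a k)` for extended nonnegative random quantities `R k`, each on its own
probability space. -/
def IsLittleOP {Ω : ℕ → Type*} [∀ k, MeasurableSpace (Ω k)] (μ : ∀ k, Measure (Ω k))
    (R : ∀ k, Ω k → ℝ≥0∞) (a : ℕ → ℝ) : Prop :=
  ∀ ε : ℝ, 0 < ε →
    Tendsto (fun k => μ k {ω | ENNReal.ofReal (ε * a k) ≤ R k ω}) atTop (𝓝 0)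

/-! ## Estimators and test statistics

`L` is a labeled sample, `U` an unlabeled sample, `g` the (known) regression function. -/

section Statistics

variable {n m n₁ m₁ n₂ m₂ : ℕ}

/-- Average of `g` over all `n + m` covariates. -/
def covMean (g : 𝒱 → ℝ) (L : Fin n → 𝒳 × 𝒱) (U : Fin m → 𝒱) : ℝ :=
  (∑ i, g (L i).2 + ∑ j, g (U j)) / (n + m)

/-- The semi-supervised mean estimator `μ̂`. -/
def meanEst (f : 𝒳 → ℝ) (g : 𝒱 → ℝ) (L : Fin n → 𝒳 × 𝒱) (U : Fin m → 𝒱) : ℝ :=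
  (∑ i, (f (L i).1 - g (L i).2)) / n + covMean g L U

/-- `σ̂₁²`. -/
def sigma1SqEst (f : 𝒳 → ℝ) (g : 𝒱 → ℝ) (L : Fin n → 𝒳 × 𝒱) : ℝ :=
  (∑ i, (f (L i).1 - g (L i).2) ^ 2) / n

/-- `σ̂₂²`. -/
def sigma2SqEst (g : 𝒱 → ℝ) (L : Fin n → 𝒳 × 𝒱) (U : Fin m → 𝒱) : ℝ :=
  (∑ i, (g (L i).2 - covMean g L U) ^ 2 + ∑ j, (g (U j) - covMean g L U) ^ 2) / (n + m)

/-- `σ̂² = σ̂₁² / n + σ̂₂² / (n + m)`. -/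
def sigmaSqEst (f : 𝒳 → ℝ) (g : 𝒱 → ℝ) (L : Fin n → 𝒳 × 𝒱) (U : Fin m → 𝒱) : ℝ :=
  sigma1SqEst f g L / n + sigma2SqEst g L U / (n + m)

/-- The oracle statistic `(μ̂_X - μ̂_Y) / √(σ̂²_X + σ̂²_Y)`. -/
def oracleStat (f : 𝒳 → ℝ) (gX gY : 𝒱 → ℝ)
    (LX : Fin n₁ → 𝒳 × 𝒱) (UV : Fin m₁ → 𝒱) (LY : Fin n₂ → 𝒳 × 𝒱) (UW : Fin m₂ → 𝒱) : ℝ :=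
  (meanEst f gX LX UV - meanEst f gY LY UW) / √(sigmaSqEst f gX LX UV + sigmaSqEst f gY LY UW)

/-- Sample mean of `f`. -/
def sampleMean (f : 𝒳 → ℝ) (L : Fin n → 𝒳 × 𝒱) : ℝ := (∑ i, f (L i).1) / n

/-- Unbiased sample variance of `f`. -/
def sampleVar (f : 𝒳 → ℝ) (L : Fin n → 𝒳 × 𝒱) : ℝ :=
  (∑ i, (f (L i).1 - sampleMean f L) ^ 2) / ((n : ℝ) - 1)

/-- The two-sample `t`-statistic, with separate sample variances. -/
def tStat (f : 𝒳 → ℝ) (LX : Fin n₁ → 𝒳 × 𝒱) (LY : Fin n₂ → 𝒳 × 𝒱) : ℝ :=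
  (sampleMean f LX - sampleMean f LY) / √(sampleVar f LX / n₁ + sampleVar f LY / n₂)

/-- Sampling model: the randomness `ξ` of the feature, the labeled samples `LX` (i.i.d. from `P`)
and `LY` (i.i.d. from `Q`), and the unlabeled samples `UV` and `UW` (i.i.d. from the covariate
marginals of `P` and `Q`) are mutually independent. -/
def IsSemiSupervisedSample {Ω Θ : Type*} [MeasurableSpace Ω] [MeasurableSpace Θ]
    (μ : Measure Ω) (P Q : Measure (𝒳 × 𝒱)) (ξ : Ω → Θ)
    (LX : Ω → Fin n₁ → 𝒳 × 𝒱) (UV : Ω → Fin m₁ → 𝒱)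
    (LY : Ω → Fin n₂ → 𝒳 × 𝒱) (UW : Ω → Fin m₂ → 𝒱) : Prop :=
  HasLaw (fun ω => (ξ ω, (LX ω, UV ω), (LY ω, UW ω)))
    ((μ.map ξ).prod
      (((Measure.pi fun _ : Fin n₁ => P).prod (Measure.pi fun _ : Fin m₁ => P.snd)).prod
        ((Measure.pi fun _ : Fin n₂ => Q).prod (Measure.pi fun _ : Fin m₂ => Q.snd)))) μ

/-- Unconditional probability that the one-sided oracle test `T > z_{1-α}` rejects. -/
def oraclePower {Ω Θ : Type*} [MeasurableSpace Ω] (μ : Measure Ω) (α : ℝ) (ξ : Ω → Θ)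
    (f : Θ → 𝒳 → ℝ) (gX gY : Θ → 𝒱 → ℝ)
    (LX : Ω → Fin n₁ → 𝒳 × 𝒱) (UV : Ω → Fin m₁ → 𝒱)
    (LY : Ω → Fin n₂ → 𝒳 × 𝒱) (UW : Ω → Fin m₂ → 𝒱) : ℝ :=
  μ.real {ω | normalQuantile (1 - α) <
    oracleStat (f (ξ ω)) (gX (ξ ω)) (gY (ξ ω)) (LX ω) (UV ω) (LY ω) (UW ω)}

/-- Unconditional probability that the two-sample `t`-test with critical value `c` rejects. -/
def tPower {Ω Θ : Type*} [MeasurableSpace Ω] (μ : Measure Ω) (c : ℝ) (ξ : Ω → Θ)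
    (f : Θ → 𝒳 → ℝ) (LX : Ω → Fin n₁ → 𝒳 × 𝒱) (LY : Ω → Fin n₂ → 𝒳 × 𝒱) : ℝ :=
  μ.real {ω | c < tStat (f (ξ ω)) (LX ω) (LY ω)}

end Statistics

end SemiSupervised

end

open SemiSupervised

/-!
Conditionally on the feature `f`, the centered estimator `μ̂_X - E[f(X)]` is a sum of two independent
blocks of i.i.d. variables: the labeled observations contribute
`{f(X) - g(V)} / n₁ + {g(V) - E[f(X)]} / (n₁ + m₁)`, the unlabeled ones the second term alone. The
residual `f(X) - g(V)` and the centered regression function `g(V) - E[f(X)]` are orthogonal with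
variances `σ₁²` and `σ₂²`, so the variance of the sum is `σ₁² / n₁ + σ₂² / (n₁ + m₁)`
(`LyapunovFeature.nearNormal_meanEst`). The moment condition is Lyapunov's condition for each of the
two components, relative to its own standard deviation; this is why the minimum of `σ₁` and `σ₂`
appears in it, and why it suffices for all values of `m₁`.

The feature changes with `k` and is random, so every approximation is proved in a non-asymptotic
form, uniform over all laws, features and unlabeled sample sizes for which the moment ratio is at
most a small multiple of `n ^ (δ / 2)` (`exists_conditional_power_approx`). Three facts enter.

* The central limit theorem, by Lindeberg's replacement of the summands by Gaussian ones. In terms of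
  laws, this is the observation that the errors on translates of a fixed smooth function add up under
  convolution (`CloseOn.conv`). A smooth approximation of an indicator then gives a bound on tails
  that is uniform in the threshold (`abs_measureReal_Ioi_sub_normalCDF_le`); the uniformity is needed
  because the standardized mean difference is unrestricted.
* The weak law of large numbers for squares, by truncation (`integral_abs_sum_sq_sub_le`), which
  gives consistency in mean of the variance estimators relative to the variances they estimate
  (`LyapunovFeature.relConsistent_sigmaSqEst`, `LyapunovFeature.relConsistent_sampleVar`).
* A Slutsky argument for the studentized difference (`abs_studentized_power_sub_le`).

The moment condition in probability says that the feature is of this kind off an event of small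
probability, and integrating over the feature gives the unconditional power
(`tendsto_measureReal_sub_integral`). For the size, the standardized mean difference vanishes. For
the comparison, the `t`-statistic has the numerator of the oracle statistic with `m₁ = m₂ = 0`, so
both competitors have the limiting power of that case; and passing to `m₁ = m₂ = 0` increases the
variance, hence decreases a nonnegative standardized mean difference (`standardizedShift_zero_le`).
-/

namespace SemiSupervised

/-! ### Smooth test functions -/

/-- Test functions for the Lindeberg replacement argument: bounded by `1` and with a second order
Taylor expansion whose remainder is `O(y ^ 2)` for large and `O(|y| ^ 3)` for small increments `y`,
uniformly in the base point. The coefficients of the expansion are left unspecified. -/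
structure SmoothTest (h : ℝ → ℝ) (K : ℝ) : Prop where
  continuous : Continuous h
  bound : ∀ x, |h x| ≤ 1
  taylor : ∃ a b : ℝ → ℝ, ∀ x y,
    |h (x + y) - (h x + a x * y + b x * y ^ 2)| ≤ K * min (y ^ 2) (|y| ^ 3)

lemma abs_taylor_remainder_le {f : ℝ → ℝ} (hf : ContDiff ℝ 3 f) {K : ℝ}
    (h2 : ∀ x, |iteratedDeriv 2 f x| ≤ K) (h3 : ∀ x, |iteratedDeriv 3 f x| ≤ K) (x y : ℝ) :
    |f (x + y) - (f x + deriv f x * y + iteratedDeriv 2 f x / 2 * y ^ 2)|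
      ≤ K * min (y ^ 2) (|y| ^ 3) := by
  have hK : 0 ≤ K := (abs_nonneg _).trans (h2 0)
  rcases eq_or_ne y 0 with rfl | hy
  · simp
  have hne : x ≠ x + y := by simpa using hy
  have hu : UniqueDiffOn ℝ (Set.uIcc x (x + y)) := uniqueDiffOn_Icc (by simpa using hne)
  have hd1 : iteratedDerivWithin 1 f (Set.uIcc x (x + y)) x = deriv f x := by
    rw [iteratedDerivWithin_eq_iteratedDeriv hu
      (hf.contDiffAt.of_le (by norm_num)) Set.left_mem_uIcc, iteratedDeriv_one]
  have hd2 : iteratedDerivWithin 2 f (Set.uIcc x (x + y)) x = iteratedDeriv 2 f x := by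
    rw [iteratedDerivWithin_eq_iteratedDeriv hu
      (hf.contDiffAt.of_le (by norm_num)) Set.left_mem_uIcc]
  obtain ⟨u, -, hu1⟩ := taylor_mean_remainder_lagrange_iteratedDeriv (n := 1) hne
    (hf.contDiffOn.of_le (by norm_num))
  obtain ⟨w, -, hw1⟩ := taylor_mean_remainder_lagrange_iteratedDeriv (n := 2) hne
    (hf.contDiffOn.of_le (by norm_num))
  simp only [taylorWithinEval_succ, taylor_within_zero_eval, zero_add, hd1, hd2, Nat.reduceAdd,
    add_sub_cancel_left, smul_eq_mul, Nat.factorial, Nat.cast_one] at hu1 hw1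
  rw [mul_min_of_nonneg _ _ hK]
  refine le_min ?_ ?_
  · have : f (x + y) - (f x + deriv f x * y + iteratedDeriv 2 f x / 2 * y ^ 2)
        = (iteratedDeriv 2 f u - iteratedDeriv 2 f x) * (y ^ 2 / 2) := by
      norm_num at hu1 ⊢
      linarith
    rw [this, abs_mul, abs_of_nonneg (by positivity : 0 ≤ y ^ 2 / 2)]
    have h4 : |iteratedDeriv 2 f u - iteratedDeriv 2 f x| ≤ 2 * K :=
      (abs_sub _ _).trans (by linarith [h2 u, h2 x])
    calc _ ≤ 2 * K * (y ^ 2 / 2) := by gcongr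
      _ = _ := by ring
  · have : f (x + y) - (f x + deriv f x * y + iteratedDeriv 2 f x / 2 * y ^ 2)
        = iteratedDeriv 3 f w * (y ^ 3 / 6) := by
      norm_num at hw1 ⊢
      linarith
    rw [this, abs_mul, abs_div, abs_pow]
    have : |y| ^ 3 / |6| ≤ |y| ^ 3 := by
      rw [abs_of_pos (by norm_num : (0 : ℝ) < 6)]
      exact div_le_self (by positivity) (by norm_num)
    gcongr
    exact h3 w

/-- A smooth approximation of the indicator of the positive half-line, with transition zone
`[0, η]`. -/
lemma exists_smoothTest_step {η : ℝ} (hη : 0 < η) :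
    ∃ K : ℝ, 0 < K ∧ ∃ h : ℝ → ℝ, SmoothTest h K ∧ (∀ x, 0 ≤ h x) ∧ (∀ x, h x ≤ 1) ∧
      (∀ x ≤ 0, h x = 0) ∧ (∀ x, η ≤ x → h x = 1) := by
  set h : ℝ → ℝ := fun x => Real.smoothTransition (x / η) with hh
  have hc : ContDiff ℝ 3 h := (Real.smoothTransition.contDiff (n := 3)).comp (by fun_prop)
  have h0 : ∀ x ≤ 0, h x = 0 := fun x hx =>
    Real.smoothTransition.zero_of_nonpos (div_nonpos_of_nonpos_of_nonneg hx hη.le)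
  have h1 : ∀ x, η ≤ x → h x = 1 := fun x hx =>
    Real.smoothTransition.one_of_one_le ((one_le_div hη).2 hx)
  have hs : HasCompactSupport (deriv h) := by
    refine HasCompactSupport.intro (isCompact_Icc (a := (0 : ℝ)) (b := η)) fun x hx => ?_
    rw [Set.mem_Icc, not_and_or, not_le, not_le] at hx
    rcases hx with hx | hx
    · rw [(show h =ᶠ[𝓝 x] fun _ => 0 from ?_).deriv_eq]
      · simp
      · filter_upwards [Iio_mem_nhds hx] with y hy using h0 y hy.le
    · rw [(show h =ᶠ[𝓝 x] fun _ => 1 from ?_).deriv_eq]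
      · simp
      · filter_upwards [Ioi_mem_nhds hx] with y hy using h1 y hy.le
  have e2 : iteratedDeriv 2 h = deriv (deriv h) := by simp [iteratedDeriv_succ, iteratedDeriv_zero]
  have e3 : iteratedDeriv 3 h = deriv (deriv (deriv h)) := by
    simp [iteratedDeriv_succ, iteratedDeriv_zero]
  obtain ⟨C2, hC2⟩ := HasCompactSupport.exists_bound_of_continuous (f := iteratedDeriv 2 h)
    (by rw [e2]; exact hs.deriv) (hc.continuous_iteratedDeriv 2 (by norm_num))
  obtain ⟨C3, hC3⟩ := HasCompactSupport.exists_bound_of_continuous (f := iteratedDeriv 3 h)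
    (by rw [e3]; exact hs.deriv.deriv) (hc.continuous_iteratedDeriv 3 (by norm_num))
  refine ⟨max 1 (max C2 C3), by positivity, h, ⟨hc.continuous, fun x => ?_, deriv h,
    fun x => iteratedDeriv 2 h x / 2, ?_⟩, fun x => Real.smoothTransition.nonneg _,
    fun x => Real.smoothTransition.le_one _, h0, h1⟩
  · rw [abs_of_nonneg (Real.smoothTransition.nonneg _)]
    exact Real.smoothTransition.le_one _
  · exact abs_taylor_remainder_le hc
      (fun x => (hC2 x).trans ((le_max_left _ _).trans (le_max_right _ _)))
      (fun x => (hC3 x).trans ((le_max_right _ _).trans (le_max_right _ _)))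

/-! ### Distance of laws through a test function, and Lindeberg replacement -/

/-- `ν` and `γ` integrate all translates of `h` alike, up to `d`. -/
def CloseOn (h : ℝ → ℝ) (ν γ : Measure ℝ) (d : ℝ) : Prop :=
  ∀ x, |∫ y, h (x + y) ∂ν - ∫ y, h (x + y) ∂γ| ≤ d

lemma SmoothTest.integrable {h : ℝ → ℝ} {K : ℝ} (hh : SmoothTest h K) (ν : Measure ℝ)
    [IsProbabilityMeasure ν] (x : ℝ) : Integrable (fun y => h (x + y)) ν :=
  Integrable.of_bound (C := 1)
    (hh.continuous.comp (by fun_prop : Continuous fun y => x + y)).aestronglyMeasurable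
    (Eventually.of_forall fun y => hh.bound _)

lemma abs_integral_le_of_forall_abs_le {α : Type*} [MeasurableSpace α] {ν : Measure α}
    [IsProbabilityMeasure ν] {F : α → ℝ} {d : ℝ} (hF : ∀ y, |F y| ≤ d) : |∫ y, F y ∂ν| ≤ d := by
  simpa using norm_integral_le_of_norm_le_const (μ := ν) (f := F) (C := d) (Eventually.of_forall hF)

/-- Replacing the factors of a convolution one by one adds up the errors. -/
lemma CloseOn.conv {h : ℝ → ℝ} {K d d' : ℝ} (hh : SmoothTest h K) {ν γ ν' γ' : Measure ℝ}
    [IsProbabilityMeasure ν] [IsProbabilityMeasure γ] [IsProbabilityMeasure ν']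
    [IsProbabilityMeasure γ'] (h1 : CloseOn h ν γ d) (h2 : CloseOn h ν' γ' d') :
    CloseOn h (ν ∗ ν') (γ ∗ γ') (d + d') := by
  intro x
  have hi : ∀ (ν ν' : Measure ℝ) [IsProbabilityMeasure ν] [IsProbabilityMeasure ν'],
      Integrable (fun p : ℝ × ℝ => h (x + p.1 + p.2)) (ν.prod ν') := fun ν ν' _ _ =>
    Integrable.of_bound (C := 1)
      (hh.continuous.comp
        (by fun_prop : Continuous fun p : ℝ × ℝ => x + p.1 + p.2)).aestronglyMeasurable
      (Eventually.of_forall fun y => hh.bound _)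
  have e : ∀ (ν ν' : Measure ℝ) [IsProbabilityMeasure ν] [IsProbabilityMeasure ν'],
      ∫ y, h (x + y) ∂(ν ∗ ν') = ∫ y, ∫ z, h (x + y + z) ∂ν' ∂ν := by
    intro ν ν' _ _
    rw [integral_conv (hh.integrable _ _)]
    simp_rw [add_assoc]
  -- replace `ν'` by `γ'`, then `ν` by `γ`
  have key1 : |∫ y, ∫ z, h (x + y + z) ∂ν' ∂ν - ∫ y, ∫ z, h (x + y + z) ∂γ' ∂ν| ≤ d' := by
    rw [← integral_sub (hi ν ν').integral_prod_left (hi ν γ').integral_prod_left]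
    refine abs_integral_le_of_forall_abs_le fun y => ?_
    exact h2 (x + y)
  have key2 : |∫ y, ∫ z, h (x + y + z) ∂γ' ∂ν - ∫ y, ∫ z, h (x + y + z) ∂γ' ∂γ| ≤ d := by
    rw [integral_integral_swap (f := fun y z => h (x + y + z)) (hi ν γ'),
      integral_integral_swap (f := fun y z => h (x + y + z)) (hi γ γ'),
      ← integral_sub (hi ν γ').integral_prod_right (hi γ γ').integral_prod_right]
    refine abs_integral_le_of_forall_abs_le fun z => ?_
    have := h1 (x + z)
    simp only [add_right_comm x z] at this
    exact this
  rw [e, e]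
  calc _ = |(∫ y, ∫ z, h (x + y + z) ∂ν' ∂ν - ∫ y, ∫ z, h (x + y + z) ∂γ' ∂ν)
        + (∫ y, ∫ z, h (x + y + z) ∂γ' ∂ν - ∫ y, ∫ z, h (x + y + z) ∂γ' ∂γ)| := by ring_nf
    _ ≤ _ := (abs_add_le _ _).trans (by linarith)

/-- Two centered laws with equal variance are close on a smooth test function, as the Taylor
expansions agree up to second order. -/
lemma closeOn_of_moments {h : ℝ → ℝ} {K : ℝ} (hh : SmoothTest h K) {ν γ : Measure ℝ}
    [IsProbabilityMeasure ν] [IsProbabilityMeasure γ]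
    (hν : MemLp id 2 ν) (hγ : MemLp id 2 γ) (hν0 : ∫ y, y ∂ν = 0) (hγ0 : ∫ y, y ∂γ = 0)
    (hv : ∫ y, y ^ 2 ∂ν = ∫ y, y ^ 2 ∂γ) :
    CloseOn h ν γ (K * (∫ y, min (y ^ 2) (|y| ^ 3) ∂ν + ∫ y, min (y ^ 2) (|y| ^ 3) ∂γ)) := by
  obtain ⟨a, b, hab⟩ := hh.taylor
  intro x
  have key : ∀ (ν : Measure ℝ) [IsProbabilityMeasure ν], MemLp id 2 ν → ∫ y, y ∂ν = 0 →
      |∫ y, h (x + y) ∂ν - (h x + b x * ∫ y, y ^ 2 ∂ν)| ≤ K * ∫ y, min (y ^ 2) (|y| ^ 3) ∂ν := by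
    intro ν _ h2 h0
    have i1 : Integrable (fun y : ℝ => y) ν := h2.integrable (by norm_num)
    have i2 : Integrable (fun y : ℝ => y ^ 2) ν := h2.integrable_sq
    have i3 : Integrable (fun y : ℝ => min (y ^ 2) (|y| ^ 3)) ν := by
      refine i2.mono' (by fun_prop) (Eventually.of_forall fun y => ?_)
      rw [Real.norm_of_nonneg (by positivity)]
      exact min_le_left _ _
    have i4 : Integrable (fun y => h x + a x * y) ν := (integrable_const _).add (i1.const_mul _)
    have i5 : Integrable (fun y => b x * y ^ 2) ν := i2.const_mul _
    have e : ∫ y, (h x + a x * y + b x * y ^ 2) ∂ν = h x + b x * ∫ y, y ^ 2 ∂ν := by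
      rw [integral_add i4 i5, integral_add (integrable_const _) (i1.const_mul _),
        integral_const_mul, integral_const_mul, h0]
      simp
    have i6 : Integrable (fun y => h x + a x * y + b x * y ^ 2) ν := i4.add i5
    rw [← e, ← integral_sub (hh.integrable _ _) i6, ← integral_const_mul]
    refine (abs_integral_le_integral_abs).trans (integral_mono_of_nonneg
      (Eventually.of_forall fun _ => abs_nonneg _) (i3.const_mul K)
      (Eventually.of_forall fun y => hab x y))
  have k1 := key ν hν hν0
  have k2 := key γ hγ hγ0
  rw [hv] at k1
  rw [abs_le] at *
  constructor <;> linarith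

/-! ### Sums of independent and identically distributed variables -/

section IID

variable {E : Type*} [MeasurableSpace E] {ρ : Measure E} [IsProbabilityMeasure ρ]

lemma map_pi_sum_succ {φ : E → ℝ} (hφ : Measurable φ) (n : ℕ) :
    (Measure.pi fun _ : Fin (n + 1) => ρ).map (fun x => ∑ i, φ (x i))
      = ρ.map φ ∗ (Measure.pi fun _ : Fin n => ρ).map (fun x => ∑ i, φ (x i)) := by
  have hs : Measurable fun x : Fin n → E => ∑ i, φ (x i) := by fun_prop
  rw [Measure.conv, Measure.map_prod_map _ _ hφ hs, Measure.map_map (by fun_prop) (by fun_prop),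
    ← (measurePreserving_piFinSuccAbove (fun _ : Fin (n + 1) => ρ) 0).map_eq,
    Measure.map_map (by fun_prop) (by fun_prop)]
  congr 1
  funext x
  simp [Fin.sum_univ_succ, MeasurableEquiv.piFinSuccAbove, Fin.tail]

lemma CloseOn.pi_sum {h : ℝ → ℝ} {K d : ℝ} (hh : SmoothTest h K) {φ : E → ℝ} (hφ : Measurable φ)
    {v : NNReal} (hd : CloseOn h (ρ.map φ) (gaussianReal 0 v) d) (n : ℕ) :
    CloseOn h ((Measure.pi fun _ : Fin n => ρ).map (fun x => ∑ i, φ (x i)))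
      (gaussianReal 0 (n * v)) (n * d) := by
  have := Measure.isProbabilityMeasure_map (μ := ρ) hφ.aemeasurable
  induction n with
  | zero =>
    intro x
    simp [Measure.map_const]
  | succ n ih =>
    have := Measure.isProbabilityMeasure_map (μ := Measure.pi fun _ : Fin n => ρ)
      (by fun_prop : Measurable fun x : Fin n → E => ∑ i, φ (x i)).aemeasurable
    rw [map_pi_sum_succ hφ]
    convert hd.conv hh ih using 1
    · rw [gaussianReal_conv_gaussianReal]
      congr 1
      · simp
      · push_cast; ring
    · push_cast; ring

lemma integral_abs_cube_gaussianReal (v : NNReal) :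
    ∫ y, |y| ^ 3 ∂(gaussianReal 0 v) = (∫ y, |y| ^ 3 ∂(gaussianReal 0 1)) * (v * √v) := by
  have e : gaussianReal 0 v = (gaussianReal 0 1).map (fun y => √v * y) := by
    rw [gaussianReal_map_const_mul]
    congr 1
    · simp
    · ext
      simp [Real.sq_sqrt]
  rw [e, integral_map (by fun_prop) (by fun_prop), mul_comm, ← integral_const_mul]
  congr 1
  funext y
  rw [abs_mul, mul_pow, abs_of_nonneg (Real.sqrt_nonneg _), pow_succ,
    Real.sq_sqrt (NNReal.coe_nonneg v)]

lemma integrable_abs_cube_gaussianReal (v : NNReal) :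
    Integrable (fun y : ℝ => |y| ^ 3) (gaussianReal 0 v) := by
  have := (memLp_id_gaussianReal (μ := 0) (v := v) 3).integrable_norm_pow (by norm_num)
  simpa using this

/-- The elementary form of Lyapunov's condition implying Lindeberg's. -/
lemma min_sq_cube_le {τ δ : ℝ} (hτ : 0 < τ) (hδ : 0 < δ) (y : ℝ) :
    min (y ^ 2) (|y| ^ 3) ≤ τ * y ^ 2 + τ ^ (-δ) * |y| ^ (2 + δ) := by
  rcases le_or_gt |y| τ with h | h
  · refine (min_le_right _ _).trans ?_
    have : 0 ≤ τ ^ (-δ) * |y| ^ (2 + δ) := by positivity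
    have h2 : |y| ^ 3 ≤ τ * y ^ 2 := by
      rw [← sq_abs y, pow_succ, mul_comm]
      gcongr
    linarith
  · refine (min_le_left _ _).trans ?_
    have hy : 0 < |y| := hτ.trans h
    have : (1 : ℝ) ≤ τ ^ (-δ) * |y| ^ δ := by
      rw [Real.rpow_neg hτ.le, inv_mul_eq_div, one_le_div (by positivity)]
      gcongr
    have h2 : y ^ 2 ≤ τ ^ (-δ) * |y| ^ (2 + δ) := by
      rw [Real.rpow_add hy, Real.rpow_two, sq_abs]
      nlinarith [sq_nonneg y]
    nlinarith [sq_nonneg y]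

/-- One summand of the Lindeberg replacement. -/
lemma closeOn_map_gaussianReal {h : ℝ → ℝ} {K τ δ : ℝ} (hh : SmoothTest h K) (hK : 0 ≤ K)
    (hτ : 0 < τ) (hδ : 0 < δ) {φ : E → ℝ} (hφ : Measurable φ) (h2 : MemLp φ 2 ρ)
    (h0 : ∫ e, φ e ∂ρ = 0) {v : NNReal} (hv : ∫ e, φ e ^ 2 ∂ρ = v)
    (hp : Integrable (fun e => |φ e| ^ (2 + δ)) ρ) :
    CloseOn h (ρ.map φ) (gaussianReal 0 v)
      (K * (τ * v + τ ^ (-δ) * ∫ e, |φ e| ^ (2 + δ) ∂ρ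
        + (∫ y, |y| ^ 3 ∂(gaussianReal 0 1)) * (v * √v))) := by
  have := Measure.isProbabilityMeasure_map (μ := ρ) hφ.aemeasurable
  have hg2 : ∫ y, y ^ 2 ∂(gaussianReal 0 v) = v := by
    have := variance_fun_id_gaussianReal (μ := 0) (v := v)
    rwa [variance_of_integral_eq_zero (by fun_prop) integral_id_gaussianReal] at this
  have key := closeOn_of_moments hh (ν := ρ.map φ) (γ := gaussianReal 0 v)
    ((memLp_map_measure_iff (by fun_prop) hφ.aemeasurable).2 h2) (memLp_id_gaussianReal 2)
    (by rw [integral_map hφ.aemeasurable (by fun_prop), h0]) integral_id_gaussianReal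
    (by rw [integral_map hφ.aemeasurable (by fun_prop), hv, hg2])
  intro x
  refine (key x).trans ?_
  gcongr
  · rw [integral_map hφ.aemeasurable (by fun_prop), ← hv, ← integral_const_mul,
      ← integral_const_mul, ← integral_add (h2.integrable_sq.const_mul _) (hp.const_mul _)]
    exact integral_mono_of_nonneg (Eventually.of_forall fun e => by positivity)
      ((h2.integrable_sq.const_mul _).add (hp.const_mul _))
      (Eventually.of_forall fun e => min_sq_cube_le hτ hδ _)
  · rw [← integral_abs_cube_gaussianReal]
    exact integral_mono_of_nonneg (Eventually.of_forall fun e => by positivity)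
      (integrable_abs_cube_gaussianReal v) (Eventually.of_forall fun e => min_le_right _ _)

lemma integral_abs_le_of_integral_sq_le {X : E → ℝ} (hX : MemLp X 2 ρ) {t : ℝ} (ht : 0 < t)
    (h : ∫ e, X e ^ 2 ∂ρ ≤ t ^ 2) : ∫ e, |X e| ∂ρ ≤ t := by
  have h1 : ∫ e, |X e| ∂ρ ≤ ∫ e, (X e ^ 2 / (2 * t) + t / 2) ∂ρ := by
    refine integral_mono (hX.integrable (by norm_num)).abs
      ((hX.integrable_sq.div_const _).add (integrable_const _)) fun e => ?_
    have : X e ^ 2 / (2 * t) + t / 2 - |X e| = (|X e| - t) ^ 2 / (2 * t) := by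
      rw [← sq_abs (X e)]
      field_simp
      ring
    have h3 : 0 ≤ (|X e| - t) ^ 2 / (2 * t) := by positivity
    show |X e| ≤ X e ^ 2 / (2 * t) + t / 2
    linarith
  rw [integral_add (hX.integrable_sq.div_const _) (integrable_const _), integral_div] at h1
  have h2 : (∫ e, X e ^ 2 ∂ρ) / (2 * t) ≤ t / 2 := by
    rw [div_le_iff₀ (by positivity)]
    nlinarith
  simp only [integral_const, probReal_univ, one_smul] at h1
  linarith

lemma integral_pi_eval {X : E → ℝ} (hX : AEStronglyMeasurable X ρ) {n : ℕ} (i : Fin n) :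
    ∫ x, X (x i) ∂(Measure.pi fun _ : Fin n => ρ) = ∫ e, X e ∂ρ := by
  have := (measurePreserving_eval (fun _ : Fin n => ρ) i).map_eq
  have h4 := integral_map (μ := Measure.pi fun _ : Fin n => ρ) (φ := Function.eval i) (f := X)
    (measurable_pi_apply i).aemeasurable (by rwa [this])
  rw [this] at h4
  exact h4.symm

lemma integral_sq_sum_pi {X : E → ℝ} (hX : MemLp X 2 ρ) (h0 : ∫ e, X e ∂ρ = 0) (n : ℕ) :
    ∫ x, (∑ i, X (x i)) ^ 2 ∂(Measure.pi fun _ : Fin n => ρ) = n * ∫ e, X e ^ 2 ∂ρ := by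
  have hXi : ∀ i : Fin n, MemLp (fun x : Fin n → E => X (x i)) 2 (Measure.pi fun _ => ρ) :=
    fun i => hX.comp_measurePreserving (measurePreserving_eval _ i)
  have h1 := variance_sum_pi (μ := fun _ : Fin n => ρ) (X := fun _ => X) fun _ => hX
  have hz : ∫ x : Fin n → E, (∑ i, fun x : Fin n → E => X (x i)) x ∂(Measure.pi fun _ => ρ)
      = 0 := by
    simp only [Finset.sum_apply]
    rw [integral_finsetSum _ fun i _ => (hXi i).integrable (by norm_num)]
    simp [integral_pi_eval hX.aestronglyMeasurable, h0]
  rw [variance_of_integral_eq_zero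
    (memLp_finsetSum' _ fun i _ => hXi i).aestronglyMeasurable.aemeasurable hz,
    variance_of_integral_eq_zero hX.aestronglyMeasurable.aemeasurable h0] at h1
  simpa using h1

lemma integrable_pi_eval {X : E → ℝ} (hX : Integrable X ρ) {n : ℕ} (i : Fin n) :
    Integrable (fun x => X (x i)) (Measure.pi fun _ : Fin n => ρ) :=
  (measurePreserving_eval (fun _ : Fin n => ρ) i).integrable_comp_of_integrable hX

lemma integral_abs_sum_pi_le {X : E → ℝ} (hX : Integrable X ρ) (n : ℕ) :
    ∫ x, |∑ i, X (x i)| ∂(Measure.pi fun _ : Fin n => ρ) ≤ n * ∫ e, |X e| ∂ρ := by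
  calc _ ≤ ∫ x, ∑ i, |X (x i)| ∂(Measure.pi fun _ : Fin n => ρ) :=
        integral_mono_of_nonneg (Eventually.of_forall fun _ => abs_nonneg _)
          (integrable_finsetSum _ fun i _ => integrable_pi_eval hX.abs i)
          (Eventually.of_forall fun _ => Finset.abs_sum_le_sum_abs _ _)
    _ = n * ∫ e, |X e| ∂ρ := by
        rw [integral_finsetSum _ fun i _ => integrable_pi_eval hX.abs i]
        simp [integral_pi_eval hX.abs.aestronglyMeasurable]

/-- A weak law of large numbers in mean for squares, by truncation of `φ` at level `b`: the
truncated part `T` is controlled by its variance, the remainder `R` by the moment of order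
`2 + δ`. -/
lemma integral_abs_sum_sq_sub_le {φ : E → ℝ} (hφ : Measurable φ) (h2 : MemLp φ 2 ρ) {δ v b t : ℝ}
    (hδ : 0 < δ) (hv : ∫ e, φ e ^ 2 ∂ρ = v) (hp : Integrable (fun e => |φ e| ^ (2 + δ)) ρ)
    (hb : 0 < b) (ht : 0 < t) {n : ℕ} (hn : n * (b ^ 2 * v) ≤ t ^ 2) :
    ∫ x, |∑ i, (φ (x i) ^ 2 - v)| ∂(Measure.pi fun _ : Fin n => ρ)
      ≤ t + n * (2 * (b ^ (-δ) * ∫ e, |φ e| ^ (2 + δ) ∂ρ)) := by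
  set A : Set E := {e | |φ e| ≤ b} with hA
  have hAm : MeasurableSet A := measurableSet_le (by fun_prop) (by fun_prop)
  set T : E → ℝ := A.indicator fun e => φ e ^ 2 with hT
  set R : E → ℝ := Aᶜ.indicator fun e => φ e ^ 2 with hR
  have hTm : Measurable T := (by fun_prop : Measurable fun e => φ e ^ 2).indicator hAm
  have hTR : ∀ e, φ e ^ 2 = T e + R e := fun e =>
    (congrFun (Set.indicator_self_add_compl A fun e => φ e ^ 2) e).symm
  have hTb : ∀ e, ‖T e‖ ≤ b ^ 2 := fun e => by
    by_cases he : e ∈ A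
    · rw [hT, Set.indicator_of_mem he, Real.norm_of_nonneg (sq_nonneg _), ← sq_abs]
      have : |φ e| ≤ b := he
      gcongr
    · rw [hT, Set.indicator_of_notMem he]
      simp [sq_nonneg]
  have hT0 : ∀ e, 0 ≤ T e := fun e => Set.indicator_nonneg (fun _ _ => sq_nonneg _) e
  have hTle : ∀ e, T e ≤ φ e ^ 2 := fun e => Set.indicator_le_self' (fun _ _ => sq_nonneg _) e
  have hR0 : ∀ e, 0 ≤ R e := fun e => Set.indicator_nonneg (fun _ _ => sq_nonneg _) e
  have hT2 : MemLp T 2 ρ :=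
    MemLp.of_bound hTm.aestronglyMeasurable (b ^ 2) (Eventually.of_forall hTb)
  have hTi : Integrable T ρ := hT2.integrable (by norm_num)
  have hRi : Integrable R ρ := h2.integrable_sq.indicator hAm.compl
  have hvTR : v = ∫ e, T e ∂ρ + ∫ e, R e ∂ρ := by
    rw [← hv, ← integral_add hTi hRi]
    simp [hTR]
  have hRle : ∫ e, R e ∂ρ ≤ b ^ (-δ) * ∫ e, |φ e| ^ (2 + δ) ∂ρ := by
    rw [← integral_const_mul]
    refine integral_mono hRi (hp.const_mul _) fun e => ?_
    by_cases he : e ∈ A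
    · have : e ∉ Aᶜ := by simpa using he
      simp only [hR, Set.indicator_of_notMem this]
      positivity
    · have he' : e ∈ Aᶜ := he
      simp only [hR, Set.indicator_of_mem he']
      have hlt : b < |φ e| := not_le.1 he
      have h3 : (1 : ℝ) ≤ b ^ (-δ) * |φ e| ^ δ := by
        rw [Real.rpow_neg hb.le, inv_mul_eq_div, one_le_div (by positivity)]
        gcongr
      rw [Real.rpow_add (hb.trans hlt), Real.rpow_two, sq_abs]
      nlinarith [sq_nonneg (φ e)]
  set X : E → ℝ := fun e => T e - ∫ e, T e ∂ρ with hXd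
  have hX2 : MemLp X 2 ρ := hT2.sub (memLp_const _)
  have hX0 : ∫ e, X e ∂ρ = 0 := by
    rw [hXd, integral_sub hTi (integrable_const _)]
    simp
  have hXsq : ∫ e, X e ^ 2 ∂ρ ≤ b ^ 2 * v := by
    have e1 : ∫ e, X e ^ 2 ∂ρ = variance T ρ := (variance_eq_integral hTm.aemeasurable).symm
    rw [e1]
    refine (variance_le_expectation_sq hTm.aestronglyMeasurable).trans ?_
    rw [← hv, ← integral_const_mul]
    refine integral_mono hT2.integrable_sq (h2.integrable_sq.const_mul _) fun e => ?_
    have h5 : T e ≤ b ^ 2 := (le_abs_self _).trans (hTb e)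
    have := hTle e
    have h6 := hT0 e
    simp only [Pi.pow_apply]
    nlinarith
  have hS : ∫ x, |∑ i, X (x i)| ∂(Measure.pi fun _ : Fin n => ρ) ≤ t := by
    refine integral_abs_le_of_integral_sq_le ?_ ht ?_
    · exact memLp_finsetSum _ fun i _ =>
        hX2.comp_measurePreserving (measurePreserving_eval (fun _ : Fin n => ρ) i)
    · rw [integral_sq_sum_pi hX2 hX0]
      refine le_trans ?_ hn
      gcongr
  set Y : E → ℝ := fun e => R e - ∫ e, R e ∂ρ with hYd
  have hYi : Integrable Y ρ := hRi.sub (integrable_const _)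
  have hY : ∫ e, |Y e| ∂ρ ≤ 2 * ∫ e, R e ∂ρ := by
    calc ∫ e, |Y e| ∂ρ ≤ ∫ e, (R e + ∫ e, R e ∂ρ) ∂ρ := by
          refine integral_mono hYi.abs (hRi.add (integrable_const _)) fun e => ?_
          refine (abs_sub _ _).trans ?_
          rw [abs_of_nonneg (hR0 e), abs_of_nonneg (integral_nonneg hR0)]
      _ = _ := by
          rw [integral_add hRi (integrable_const _)]
          simp
          ring
  have hsum : ∀ x : Fin n → E, ∑ i, (φ (x i) ^ 2 - v) = ∑ i, X (x i) + ∑ i, Y (x i) := by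
    intro x
    rw [← Finset.sum_add_distrib]
    refine Finset.sum_congr rfl fun i _ => ?_
    rw [hTR, hvTR]
    simp only [hXd, hYd]
    ring
  have iX : Integrable (fun x : Fin n → E => |∑ i, X (x i)|) (Measure.pi fun _ => ρ) :=
    (integrable_finsetSum _ fun i _ => integrable_pi_eval (hX2.integrable (by norm_num)) i).abs
  have iY : Integrable (fun x : Fin n → E => |∑ i, Y (x i)|) (Measure.pi fun _ => ρ) :=
    (integrable_finsetSum _ fun i _ => integrable_pi_eval hYi i).abs
  calc _ ≤ ∫ x, (|∑ i, X (x i)| + |∑ i, Y (x i)|) ∂(Measure.pi fun _ : Fin n => ρ) := by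
        refine integral_mono_of_nonneg (Eventually.of_forall fun _ => abs_nonneg _) (iX.add iY)
          (Eventually.of_forall fun x => ?_)
        simp only [hsum]
        exact abs_add_le _ _
    _ = _ := integral_add iX iY
    _ ≤ t + n * (2 * (b ^ (-δ) * ∫ e, |φ e| ^ (2 + δ) ∂ρ)) := by
        gcongr
        refine (integral_abs_sum_pi_le hYi n).trans ?_
        gcongr
        linarith

/-- The weak law of large numbers for squares in the scaling of the Lyapunov condition. -/
lemma integral_abs_sum_sq_sub_le_of_moment {φ : E → ℝ} (hφ : Measurable φ) (h2 : MemLp φ 2 ρ)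
    {δ σ τ ε : ℝ} (hδ : 0 < δ) (hσ : 0 < σ) (hτ : 0 < τ) (hv : ∫ e, φ e ^ 2 ∂ρ = σ ^ 2)
    (hp : Integrable (fun e => |φ e| ^ (2 + δ)) ρ) {N n : ℕ} (hN : 0 < N) (hn : n ≤ N)
    (hM : ∫ e, |φ e| ^ (2 + δ) ∂ρ ≤ ε * (N : ℝ) ^ (δ / 2) * σ ^ (2 + δ)) :
    ∫ x, |∑ i, (φ (x i) ^ 2 - σ ^ 2)| ∂(Measure.pi fun _ : Fin n => ρ)
      ≤ (τ + 2 * τ ^ (-δ) * ε) * (N * σ ^ 2) := by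
  have hN' : (0 : ℝ) < N := by exact_mod_cast hN
  have hnN : (n : ℝ) ≤ N := by exact_mod_cast hn
  have hsq : √(N : ℝ) ^ 2 = N := Real.sq_sqrt hN'.le
  refine (integral_abs_sum_sq_sub_le hφ h2 hδ hv hp (b := τ * √N * σ) (t := τ * (N * σ ^ 2))
    (by positivity) (by positivity) ?_).trans ?_
  · calc (n : ℝ) * ((τ * √N * σ) ^ 2 * σ ^ 2) = n * (N * (τ ^ 2 * σ ^ 4)) := by
          rw [mul_pow, mul_pow, hsq]; ring
      _ ≤ N * (N * (τ ^ 2 * σ ^ 4)) := by gcongr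
      _ = _ := by ring
  · have hpw : (τ * √N * σ) ^ (-δ) * (ε * (N : ℝ) ^ (δ / 2) * σ ^ (2 + δ))
        = τ ^ (-δ) * ε * σ ^ 2 := by
      rw [Real.mul_rpow (by positivity) hσ.le, Real.mul_rpow hτ.le (by positivity),
        Real.sqrt_eq_rpow, ← Real.rpow_mul hN'.le]
      have e1 : (N : ℝ) ^ (1 / 2 * -δ) * (N : ℝ) ^ (δ / 2) = 1 := by
        rw [← Real.rpow_add hN']; ring_nf; simp
      have e2 : σ ^ (-δ) * σ ^ (2 + δ) = σ ^ 2 := by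
        rw [← Real.rpow_add hσ]; ring_nf; simp
      calc _ = τ ^ (-δ) * ε * ((N : ℝ) ^ (1 / 2 * -δ) * (N : ℝ) ^ (δ / 2))
            * (σ ^ (-δ) * σ ^ (2 + δ)) := by ring
        _ = _ := by rw [e1, e2]; ring
    have h0 : 0 ≤ ∫ e, |φ e| ^ (2 + δ) ∂ρ := integral_nonneg fun _ => by positivity
    have h1 : (τ * √N * σ) ^ (-δ) * ∫ e, |φ e| ^ (2 + δ) ∂ρ ≤ τ ^ (-δ) * ε * σ ^ 2 := by
      rw [← hpw]
      gcongr
    have h2 : 0 ≤ (τ * √N * σ) ^ (-δ) * ∫ e, |φ e| ^ (2 + δ) ∂ρ := by positivity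
    calc _ ≤ τ * (N * σ ^ 2) + N * (2 * (τ ^ (-δ) * ε * σ ^ 2)) := by gcongr
      _ = _ := by ring

end IID

/-! ### Moments of the regression decomposition -/

section Population

variable {𝒳 𝒱 : Type*} [MeasurableSpace 𝒳] [MeasurableSpace 𝒱]

/-- The residual `f(X) - E[f(X) | V]`. -/
def resid (f : 𝒳 → ℝ) (g : 𝒱 → ℝ) (p : 𝒳 × 𝒱) : ℝ := f p.1 - g p.2

/-- The centered regression function `E[f(X) | V] - E[f(X)]`. -/
noncomputable def cmean (P : Measure (𝒳 × 𝒱)) (f : 𝒳 → ℝ) (g : 𝒱 → ℝ) (p : 𝒳 × 𝒱) : ℝ :=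
  g p.2 - popMean P f

/-- Non-asymptotic Lyapunov condition, at sample size `n` and level `ε`, for the two orthogonal
components of `f(X) - E[f(X)]`, with standard deviations `σ₁` and `σ₂`, and for their sum. -/
structure LyapunovFeature (P : Measure (𝒳 × 𝒱)) (f : 𝒳 → ℝ) (g : 𝒱 → ℝ) (σ₁ σ₂ δ ε : ℝ)
    (n : ℕ) : Prop where
  pos₁ : 0 < σ₁
  pos₂ : 0 < σ₂
  sigma₁ : sigma1Sq P f = σ₁ ^ 2
  sigma₂ : sigma2Sq P f = σ₂ ^ 2
  memLp_resid : MemLp (resid f g) 2 P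
  memLp_cmean : MemLp (cmean P f g) 2 P
  integral_resid : ∫ p, resid f g p ∂P = 0
  integral_cmean : ∫ p, cmean P f g p ∂P = 0
  integral_resid_sq : ∫ p, resid f g p ^ 2 ∂P = σ₁ ^ 2
  integral_cmean_sq : ∫ p, cmean P f g p ^ 2 ∂P = σ₂ ^ 2
  integral_mul : ∫ p, resid f g p * cmean P f g p ∂P = 0
  integrable_resid : Integrable (fun p => |resid f g p| ^ (2 + δ)) P
  integrable_cmean : Integrable (fun p => |cmean P f g p| ^ (2 + δ)) P
  integrable_total : Integrable (fun p : 𝒳 × 𝒱 => |f p.1 - popMean P f| ^ (2 + δ)) P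
  moment_resid : ∫ p, |resid f g p| ^ (2 + δ) ∂P ≤ ε * (n : ℝ) ^ (δ / 2) * σ₁ ^ (2 + δ)
  moment_cmean : ∫ p, |cmean P f g p| ^ (2 + δ) ∂P ≤ ε * (n : ℝ) ^ (δ / 2) * σ₂ ^ (2 + δ)
  moment_total : ∫ p, |f p.1 - popMean P f| ^ (2 + δ) ∂P
    ≤ ε * (n : ℝ) ^ (δ / 2) * √(σ₁ ^ 2 + σ₂ ^ 2) ^ (2 + δ)

lemma covariateAlgebra_le : covariateAlgebra 𝒳 𝒱 ≤ Prod.instMeasurableSpace (α := 𝒳) (β := 𝒱) :=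
  measurable_snd.comap_le

lemma abs_add_rpow_le {p : ℝ} (hp : 0 ≤ p) (a b : ℝ) :
    |a + b| ^ p ≤ 2 ^ p * (|a| ^ p + |b| ^ p) := by
  have h1 : |a + b| ≤ 2 * max |a| |b| := (abs_add_le a b).trans (by
    linarith [le_max_left |a| |b|, le_max_right |a| |b|])
  calc |a + b| ^ p ≤ (2 * max |a| |b|) ^ p := by gcongr
    _ = 2 ^ p * (max |a| |b|) ^ p := Real.mul_rpow (by norm_num) (by positivity)
    _ ≤ _ := by
      gcongr
      rcases max_cases |a| |b| with ⟨h, -⟩ | ⟨h, -⟩ <;> rw [h]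
      · linarith [Real.rpow_nonneg (abs_nonneg b) p]
      · linarith [Real.rpow_nonneg (abs_nonneg a) p]

/-- A bound on the moment ratio forces positive variances and finite moments. -/
lemma moment_of_momentRatio_lt {P : Measure (𝒳 × 𝒱)} [IsProbabilityMeasure P] {f : 𝒳 → ℝ}
    (hf : Measurable f) {δ B : ℝ} (hδ : 0 < δ) (h : momentRatio δ P f < ENNReal.ofReal B) :
    0 < √(sigma1Sq P f) ∧ 0 < √(sigma2Sq P f) ∧
      Integrable (fun p : 𝒳 × 𝒱 => |f p.1 - popMean P f| ^ (2 + δ)) P ∧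
      ∫ p, |f p.1 - popMean P f| ^ (2 + δ) ∂P ≤ B * √(sigma1Sq P f) ^ (2 + δ) ∧
      ∫ p, |f p.1 - popMean P f| ^ (2 + δ) ∂P ≤ B * √(sigma2Sq P f) ^ (2 + δ) := by
  set d : ℝ := min (√(sigma1Sq P f) ^ (2 + δ)) (√(sigma2Sq P f) ^ (2 + δ)) with hd
  have hB : 0 < B := ENNReal.ofReal_pos.1 (bot_le.trans_lt h)
  have hpos : 0 < d := by
    by_contra hneg
    rw [momentRatio, if_neg hneg] at h
    exact not_top_lt h
  rw [momentRatio, if_pos hpos,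
    ENNReal.div_lt_iff (Or.inl (ENNReal.ofReal_pos.2 hpos).ne') (Or.inl ENNReal.ofReal_ne_top),
    ← ENNReal.ofReal_mul hB.le] at h
  have hm : Measurable fun p : 𝒳 × 𝒱 => |f p.1 - popMean P f| ^ (2 + δ) := by fun_prop
  have hnn : 0 ≤ᵐ[P] fun p : 𝒳 × 𝒱 => |f p.1 - popMean P f| ^ (2 + δ) :=
    Eventually.of_forall fun _ => by positivity
  have hint : Integrable (fun p : 𝒳 × 𝒱 => |f p.1 - popMean P f| ^ (2 + δ)) P :=
    ⟨hm.aestronglyMeasurable, (hasFiniteIntegral_iff_ofReal hnn).2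
      (h.trans ENNReal.ofReal_lt_top)⟩
  have hle : ∫ p, |f p.1 - popMean P f| ^ (2 + δ) ∂P ≤ B * d := by
    rw [integral_eq_lintegral_of_nonneg_ae hnn hm.aestronglyMeasurable]
    exact ENNReal.toReal_le_of_le_ofReal (by positivity) h.le
  have hroot : ∀ x : ℝ, 0 < √x ^ (2 + δ) → 0 < √x := fun x hx => by
    rcases (Real.sqrt_nonneg x).lt_or_eq with h | h
    · exact h
    · rw [← h, Real.zero_rpow (by linarith)] at hx
      exact absurd hx (lt_irrefl _)
  refine ⟨hroot _ (hpos.trans_le (min_le_left _ _)), hroot _ (hpos.trans_le (min_le_right _ _)),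
    hint, hle.trans ?_, hle.trans ?_⟩
  · gcongr
    exact min_le_left _ _
  · gcongr
    exact min_le_right _ _

lemma LyapunovFeature.of_momentRatio_lt {P : Measure (𝒳 × 𝒱)} [IsProbabilityMeasure P]
    {f : 𝒳 → ℝ} (hf : Measurable f) {g : 𝒱 → ℝ} (hg : Measurable g) (hgf : IsCondMean P f g)
    {δ ε : ℝ} (hδ : 0 < δ) {n : ℕ}
    (h : momentRatio δ P f < ENNReal.ofReal (ε * (n : ℝ) ^ (δ / 2))) :
    LyapunovFeature P f g (√(sigma1Sq P f)) (√(sigma2Sq P f)) δ (2 * 2 ^ (2 + δ) * ε) n := by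
  obtain ⟨h1, h2, hint, hM1, hM2⟩ := moment_of_momentRatio_lt hf hδ h
  set B : ℝ := ε * (n : ℝ) ^ (δ / 2) with hB
  have hBpos : 0 < B := ENNReal.ofReal_pos.1 (bot_le.trans_lt h)
  set σ₁ := √(sigma1Sq P f)
  set σ₂ := √(sigma2Sq P f)
  set M := ∫ p, |f p.1 - popMean P f| ^ (2 + δ) ∂P with hMdef
  have hm := covariateAlgebra_le (𝒳 := 𝒳) (𝒱 := 𝒱)
  have hs1 : sigma1Sq P f = σ₁ ^ 2 := (Real.sq_sqrt (Real.sqrt_pos.1 h1).le).symm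
  have hs2 : sigma2Sq P f = σ₂ ^ 2 := (Real.sq_sqrt (Real.sqrt_pos.1 h2).le).symm
  -- integrability of the feature
  set F : 𝒳 × 𝒱 → ℝ := fun p => f p.1 with hF
  set C : 𝒳 × 𝒱 → ℝ := fun p => f p.1 - popMean P f with hC
  have hp0 : ENNReal.ofReal (2 + δ) ≠ 0 := by simp; linarith
  have hpr : (ENNReal.ofReal (2 + δ)).toReal = 2 + δ := ENNReal.toReal_ofReal (by linarith)
  have hp2 : (2 : ℝ≥0∞) ≤ ENNReal.ofReal (2 + δ) := by
    rw [show (2 : ℝ≥0∞) = ENNReal.ofReal 2 by simp]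
    exact ENNReal.ofReal_le_ofReal (by linarith)
  have hCp : MemLp C (ENNReal.ofReal (2 + δ)) P := by
    rw [← integrable_norm_rpow_iff (by fun_prop) hp0 ENNReal.ofReal_ne_top, hpr]
    exact hint
  have hC2 : MemLp C 2 P := hCp.mono_exponent hp2
  have hF2 : MemLp F 2 P := by
    have := hC2.add (memLp_const (popMean P f))
    convert this using 1
    funext p
    simp [hF, hC]
  have hFi : Integrable F P := hF2.integrable (by norm_num)
  -- the regression function as a conditional expectation
  have hgf' : (fun p : 𝒳 × 𝒱 => g p.2) =ᵐ[P] P[F | covariateAlgebra 𝒳 𝒱] := hgf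
  have hW : cmean P f g =ᵐ[P] P[C | covariateAlgebra 𝒳 𝒱] := by
    have e1 : P[C | covariateAlgebra 𝒳 𝒱] =ᵐ[P] P[F | covariateAlgebra 𝒳 𝒱] - P[fun _ => popMean P f | covariateAlgebra 𝒳 𝒱] :=
      condExp_sub hFi (integrable_const _) _
    rw [condExp_const hm] at e1
    filter_upwards [e1, hgf'] with p e1 e2
    rw [e1, cmean, e2]
    rfl
  have hWp : MemLp (cmean P f g) (ENNReal.ofReal (2 + δ)) P := by
    rw [memLp_congr_ae hW]
    exact MemLp.condExp (le_trans (by norm_num) hp2) hCp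
  have hW2 : MemLp (cmean P f g) 2 P := hWp.mono_exponent hp2
  have hUC : ∀ p, resid f g p = C p - cmean P f g p := fun p => by
    simp only [resid, cmean, hC]; ring
  have hUfun : resid f g = C - cmean P f g := funext hUC
  have hU2 : MemLp (resid f g) 2 P := by rw [hUfun]; exact hC2.sub hW2
  have hUi : MemLp (resid f g) (ENNReal.ofReal (2 + δ)) P := by rw [hUfun]; exact hCp.sub hWp
  have hC0 : ∫ p, C p ∂P = 0 := by
    rw [hC, integral_sub hFi (integrable_const _)]
    simp [popMean, hF]
  have hW0 : ∫ p, cmean P f g p ∂P = 0 := by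
    rw [integral_congr_ae hW, integral_condExp hm, hC0]
  have hU0 : ∫ p, resid f g p ∂P = 0 := by
    simp only [hUC]
    rw [integral_sub (hC2.integrable (by norm_num)) (hW2.integrable (by norm_num)), hC0, hW0]
    simp
  have hUF : resid f g =ᵐ[P] F - P[F | covariateAlgebra 𝒳 𝒱] := by
    filter_upwards [hgf'] with p e2
    simp only [resid, Pi.sub_apply, hF]
    rw [← e2]
  have hsq1 : ∫ p, resid f g p ^ 2 ∂P = σ₁ ^ 2 := by
    rw [← hs1, sigma1Sq, ← setIntegral_univ, ← setIntegral_univ (f := condVar _ _ _)]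
    have hi : Integrable ((F - P[F | covariateAlgebra 𝒳 𝒱]) ^ 2) P :=
      ((memLp_congr_ae hUF).1 hU2).integrable_sq
    rw [setIntegral_condVar (hm := hm) hi MeasurableSet.univ]
    refine setIntegral_congr_ae MeasurableSet.univ ?_
    filter_upwards [hUF] with p hp _
    rw [hp]
    rfl
  have hsq2 : ∫ p, cmean P f g p ^ 2 ∂P = σ₂ ^ 2 := by
    have e : variance (P[F | covariateAlgebra 𝒳 𝒱]) P = variance (cmean P f g) P := by
      rw [← variance_congr hgf']
      exact (variance_sub_const (hg.comp measurable_snd).aestronglyMeasurable _).symm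
    rw [← hs2, sigma2Sq, e, variance_of_integral_eq_zero hW2.aestronglyMeasurable.aemeasurable hW0]
  have hsq : ∫ p, C p ^ 2 ∂P = σ₁ ^ 2 + σ₂ ^ 2 := by
    have := integral_condVar_add_variance_condExp hm hF2
    rw [← variance_of_integral_eq_zero hC2.aestronglyMeasurable.aemeasurable hC0,
      show variance C P = variance F P from
        variance_sub_const (hf.comp measurable_fst).aestronglyMeasurable _, ← this,
      ← hs1, ← hs2]
    rfl
  -- orthogonality, from the law of total variance
  have hmul : ∫ p, resid f g p * cmean P f g p ∂P = 0 := by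
    have hi : Integrable (fun p => resid f g p * cmean P f g p) P := hU2.integrable_mul hW2
    have e : ∫ p, C p ^ 2 ∂P = ∫ p, resid f g p ^ 2 ∂P
        + 2 * ∫ p, resid f g p * cmean P f g p ∂P + ∫ p, cmean P f g p ^ 2 ∂P := by
      have i2 : Integrable (fun p => resid f g p ^ 2 + 2 * (resid f g p * cmean P f g p)) P :=
        hU2.integrable_sq.add (hi.const_mul 2)
      rw [← integral_const_mul, ← integral_add hU2.integrable_sq (hi.const_mul 2),
        ← integral_add i2 hW2.integrable_sq]
      refine integral_congr_ae (Eventually.of_forall fun p => ?_)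
      simp only [hUC]
      ring
    rw [hsq, hsq1, hsq2] at e
    linarith
  -- the moments of order `2 + δ`
  have iW : Integrable (fun p => |cmean P f g p| ^ (2 + δ)) P := by
    have := hWp.integrable_norm_rpow hp0 ENNReal.ofReal_ne_top
    rwa [hpr] at this
  have iU : Integrable (fun p => |resid f g p| ^ (2 + δ)) P := by
    have := hUi.integrable_norm_rpow hp0 ENNReal.ofReal_ne_top
    rwa [hpr] at this
  have hMW : ∫ p, |cmean P f g p| ^ (2 + δ) ∂P ≤ M := by
    have e : eLpNorm (cmean P f g) (ENNReal.ofReal (2 + δ)) P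
        ≤ eLpNorm C (ENNReal.ofReal (2 + δ)) P := by
      rw [eLpNorm_congr_ae hW]
      exact eLpNorm_condExp_le_eLpNorm _ (le_trans (by norm_num) hp2)
    rw [hWp.eLpNorm_eq_integral_rpow_norm hp0 ENNReal.ofReal_ne_top,
      hCp.eLpNorm_eq_integral_rpow_norm hp0 ENNReal.ofReal_ne_top, hpr,
      ENNReal.ofReal_le_ofReal_iff (by positivity)] at e
    exact (Real.rpow_le_rpow_iff (integral_nonneg fun _ => by positivity)
      (integral_nonneg fun _ => by positivity) (by positivity)).1 e
  have hM0 : 0 ≤ M := integral_nonneg fun _ => by positivity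
  have hMU : ∫ p, |resid f g p| ^ (2 + δ) ∂P ≤ 2 * 2 ^ (2 + δ) * M := by
    calc _ ≤ ∫ p, 2 ^ (2 + δ) * (|C p| ^ (2 + δ) + |cmean P f g p| ^ (2 + δ)) ∂P := by
          refine integral_mono iU ((hint.add iW).const_mul _) fun p => ?_
          have := abs_add_rpow_le (by linarith : 0 ≤ 2 + δ) (C p) (-cmean P f g p)
          rw [abs_neg, ← sub_eq_add_neg, ← hUC] at this
          exact this
      _ = 2 ^ (2 + δ) * (M + ∫ p, |cmean P f g p| ^ (2 + δ) ∂P) := by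
          rw [integral_const_mul, integral_add hint iW]
      _ ≤ 2 ^ (2 + δ) * (M + M) := by gcongr
      _ = _ := by ring
  have hc1 : (1 : ℝ) ≤ 2 * 2 ^ (2 + δ) := by
    have : (1 : ℝ) ≤ 2 ^ (2 + δ) := Real.one_le_rpow (by norm_num) (by linarith)
    linarith
  have hB' : B ≤ 2 * 2 ^ (2 + δ) * ε * (n : ℝ) ^ (δ / 2) := by
    have := mul_le_mul_of_nonneg_right hc1 hBpos.le
    rw [one_mul] at this
    refine this.trans_eq ?_
    rw [hB]; ring
  refine ⟨h1, h2, hs1, hs2, hU2, hW2, hU0, hW0, hsq1, hsq2, hmul, iU, iW, hint, ?_, ?_, ?_⟩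
  · calc _ ≤ 2 * 2 ^ (2 + δ) * M := hMU
      _ ≤ 2 * 2 ^ (2 + δ) * (B * σ₁ ^ (2 + δ)) := by gcongr
      _ = _ := by rw [hB]; ring
  · calc _ ≤ M := hMW
      _ ≤ B * σ₂ ^ (2 + δ) := hM2
      _ ≤ _ := by gcongr
  · calc M ≤ B * σ₂ ^ (2 + δ) := hM2
      _ ≤ 2 * 2 ^ (2 + δ) * ε * (n : ℝ) ^ (δ / 2) * √(σ₁ ^ 2 + σ₂ ^ 2) ^ (2 + δ) := by
        have : σ₂ ≤ √(σ₁ ^ 2 + σ₂ ^ 2) := Real.le_sqrt_of_sq_le (by nlinarith)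
        have := hBpos.le.trans hB'
        gcongr

end Population

/-! ### Normal approximation of the one-sample estimator -/

lemma CloseOn.mono {h : ℝ → ℝ} {ν γ : Measure ℝ} {d d' : ℝ} (hd : CloseOn h ν γ d)
    (hdd : d ≤ d') : CloseOn h ν γ d' := fun x => (hd x).trans hdd

/-- `A` is approximately `N(0, v)` under `ρ`: after rescaling to a variance `c ^ 2 * v ≤ 1`, the
error on smooth test functions is at most `κ` times the variance. The variance as a factor on the
right makes the bounds of independent summands add up to `κ` times the total variance. -/
def NearNormal {D : Type*} [MeasurableSpace D] (ρ : Measure D) (A : D → ℝ) (v κ : ℝ) : Prop :=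
  ∀ h K, SmoothTest h K → 0 ≤ K → ∀ c : ℝ, c ^ 2 * v ≤ 1 →
    CloseOn h (ρ.map fun d => c * A d) (gaussianReal 0 (c ^ 2 * v).toNNReal)
      (K * (κ * (c ^ 2 * v)))

lemma map_prod_add {D D' : Type*} [MeasurableSpace D] [MeasurableSpace D'] {ρ : Measure D}
    {ρ' : Measure D'} [IsProbabilityMeasure ρ] [IsProbabilityMeasure ρ'] {A : D → ℝ} {B : D' → ℝ}
    (hA : Measurable A) (hB : Measurable B) :
    (ρ.prod ρ').map (fun d => A d.1 + B d.2) = ρ.map A ∗ ρ'.map B := by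
  rw [Measure.conv, Measure.map_prod_map _ _ hA hB, Measure.map_map (by fun_prop) (by fun_prop)]
  rfl

/-- The scaling computation behind Lyapunov's condition for `N` summands of size `a / N`. -/
lemma lyapunov_scaling {a δ : ℝ} (ha : 0 ≤ a) (hδ : 0 < δ) {n N : ℕ} (hN : 0 < N) (hn : n ≤ N)
    (h : a ^ 2 / N ≤ 1) :
    N * (a ^ (2 + δ) * (n : ℝ) ^ (δ / 2) / (N : ℝ) ^ (2 + δ)) ≤ a ^ 2 / N := by
  have hN' : (0 : ℝ) < N := by exact_mod_cast hN
  have hn' : (n : ℝ) ≤ N := by exact_mod_cast hn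
  have h1 : (n : ℝ) ^ (δ / 2) ≤ (N : ℝ) ^ (δ / 2) := by gcongr
  have h2 : a ^ δ ≤ (N : ℝ) ^ (δ / 2) := by
    have : a ^ δ = (a ^ 2) ^ (δ / 2) := by
      rw [← Real.rpow_natCast a 2, ← Real.rpow_mul ha]
      congr 1
      push_cast
      ring
    rw [this]
    rw [div_le_one hN'] at h
    gcongr
  have e1 : a ^ (2 + δ) = a ^ 2 * a ^ δ := by
    rw [Real.rpow_add_of_nonneg ha (by norm_num) hδ.le, Real.rpow_two]
  have e2 : (N : ℝ) ^ (2 + δ) = N ^ 2 * ((N : ℝ) ^ (δ / 2) * (N : ℝ) ^ (δ / 2)) := by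
    rw [← Real.rpow_add hN', ← Real.rpow_two, ← Real.rpow_add hN']
    congr 1
    ring
  set M := (N : ℝ) ^ (δ / 2)
  have hM : 0 < M := by positivity
  rw [e1, e2]
  calc (N : ℝ) * (a ^ 2 * a ^ δ * (n : ℝ) ^ (δ / 2) / (N ^ 2 * (M * M)))
      ≤ N * (a ^ 2 * M * M / (N ^ 2 * (M * M))) := by gcongr
    _ = a ^ 2 / N := by
      field_simp

section OneSample

variable {𝒳 𝒱 : Type*} [MeasurableSpace 𝒳] [MeasurableSpace 𝒱] {P : Measure (𝒳 × 𝒱)}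
  {f : 𝒳 → ℝ} {g : 𝒱 → ℝ} {σ₁ σ₂ δ ε : ℝ} {n : ℕ}

lemma meanEst_sub_popMean {m : ℕ} (hn : 0 < n) (L : Fin n → 𝒳 × 𝒱) (U : Fin m → 𝒱) :
    meanEst f g L U - popMean P f =
      ∑ i, (resid f g (L i) / n + cmean P f g (L i) / (n + m))
        + ∑ j, (g (U j) - popMean P f) / (n + m) := by
  have hn' : (0 : ℝ) < n := by exact_mod_cast hn
  have hN : (0 : ℝ) < n + m := by positivity
  simp only [meanEst, covMean, resid, cmean, Finset.sum_add_distrib, ← Finset.sum_div,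
    Finset.sum_sub_distrib, Finset.sum_const, Finset.card_univ, Fintype.card_fin, nsmul_eq_mul]
  field_simp
  ring

@[fun_prop]
lemma measurable_resid (hf : Measurable f) (hg : Measurable g) : Measurable (resid f g) := by
  unfold resid
  fun_prop

@[fun_prop]
lemma measurable_cmean (hg : Measurable g) : Measurable (cmean P f g) := by
  unfold cmean
  fun_prop

namespace LyapunovFeature

lemma memLp_snd (hL : LyapunovFeature P f g σ₁ σ₂ δ ε n) (hg : Measurable g) :
    MemLp (fun v => g v - popMean P f) 2 P.snd :=
  (memLp_map_measure_iff (by fun_prop) measurable_snd.aemeasurable).2 hL.memLp_cmean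

lemma integral_snd {F : 𝒱 → ℝ} (hF : Measurable F) : ∫ v, F v ∂P.snd = ∫ p, F p.2 ∂P :=
  integral_map measurable_snd.aemeasurable hF.aestronglyMeasurable

lemma integrable_snd (hL : LyapunovFeature P f g σ₁ σ₂ δ ε n) (hg : Measurable g) :
    Integrable (fun v => |g v - popMean P f| ^ (2 + δ)) P.snd :=
  (integrable_map_measure ((hg.sub_const _).abs.pow_const _).aestronglyMeasurable
    measurable_snd.aemeasurable).2 hL.integrable_cmean

/-- Lyapunov's condition makes the moment sum of the rescaled estimator small. -/
lemma moment_sum_le (hL : LyapunovFeature P f g σ₁ σ₂ δ ε n) (hδ : 0 < δ) (hε : 0 ≤ ε)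
    (hn : 0 < n) (m : ℕ) {c : ℝ} (hc : c ^ 2 * (σ₁ ^ 2 / n + σ₂ ^ 2 / (n + m)) ≤ 1) :
    n * ∫ p, |c * (resid f g p / n + cmean P f g p / (n + m))| ^ (2 + δ) ∂P
      + m * ∫ p, |c * (cmean P f g p / (n + m))| ^ (2 + δ) ∂P
      ≤ 2 ^ (2 + δ) * ε * (c ^ 2 * (σ₁ ^ 2 / n + σ₂ ^ 2 / (n + m))) := by
  have hp : (0 : ℝ) < 2 + δ := by linarith
  have hn' : (0 : ℝ) < n := by exact_mod_cast hn
  set N : ℝ := (n : ℝ) + m with hN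
  have hNpos : (0 : ℝ) < N := by positivity
  have h1 := hL.pos₁
  have h2 := hL.pos₂
  have split : c ^ 2 * (σ₁ ^ 2 / n + σ₂ ^ 2 / N) = (|c| * σ₁) ^ 2 / n + (|c| * σ₂) ^ 2 / N := by
    rw [mul_pow, mul_pow, sq_abs]
    ring
  have ha0 : 0 ≤ (|c| * σ₁) ^ 2 / n := by positivity
  have hb0 : 0 ≤ (|c| * σ₂) ^ 2 / N := by positivity
  rw [split] at hc ⊢
  have hs1 := lyapunov_scaling (by positivity : 0 ≤ |c| * σ₁) hδ hn le_rfl (by linarith)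
  have hs2 := lyapunov_scaling (by positivity : 0 ≤ |c| * σ₂) hδ (n := n) (N := n + m)
    (by omega) (by omega) (by push_cast; rw [← hN]; linarith)
  push_cast at hs2
  rw [← hN] at hs2
  set p := 2 + δ with hpdef
  set R := ∫ q, |resid f g q| ^ p ∂P with hR
  set W := ∫ q, |cmean P f g q| ^ p ∂P with hW
  have hR0 : 0 ≤ R := integral_nonneg fun _ => by positivity
  have hW0 : 0 ≤ W := integral_nonneg fun _ => by positivity
  have eR : ∀ x k : ℝ, 0 < k → |c * (x / k)| ^ p = |c| ^ p * |x| ^ p / k ^ p := by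
    intro x k hk
    rw [abs_mul, abs_div, abs_of_pos hk, Real.mul_rpow (abs_nonneg _) (by positivity),
      Real.div_rpow (abs_nonneg _) hk.le]
    ring
  have hU : ∫ q, |c * (cmean P f g q / N)| ^ p ∂P = |c| ^ p * W / N ^ p := by
    simp only [eR _ _ hNpos]
    rw [integral_div, integral_const_mul]
  have hLb : ∫ q, |c * (resid f g q / n + cmean P f g q / N)| ^ p ∂P
      ≤ 2 ^ p * (|c| ^ p * R / (n : ℝ) ^ p + |c| ^ p * W / N ^ p) := by
    have i1 : Integrable (fun q => |c| ^ p * |resid f g q| ^ p / (n : ℝ) ^ p) P :=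
      (hL.integrable_resid.const_mul _).div_const _
    have i2 : Integrable (fun q => |c| ^ p * |cmean P f g q| ^ p / N ^ p) P :=
      (hL.integrable_cmean.const_mul _).div_const _
    calc _ ≤ ∫ q, 2 ^ p * (|c| ^ p * |resid f g q| ^ p / (n : ℝ) ^ p
          + |c| ^ p * |cmean P f g q| ^ p / N ^ p) ∂P := by
          refine integral_mono_of_nonneg (Eventually.of_forall fun _ => by positivity)
            ((i1.add i2).const_mul _) (Eventually.of_forall fun q => ?_)
          have := abs_add_rpow_le hp.le (c * (resid f g q / n)) (c * (cmean P f g q / N))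
          rw [eR _ _ hNpos, eR _ _ hn', ← mul_add] at this
          exact this
      _ = _ := by
          rw [integral_const_mul, integral_add i1 i2, integral_div, integral_const_mul,
            integral_div, integral_const_mul]
  rw [hU]
  have key1 : n * (|c| ^ p * R / (n : ℝ) ^ p) ≤ ε * ((|c| * σ₁) ^ 2 / n) := by
    calc n * (|c| ^ p * R / (n : ℝ) ^ p)
        ≤ n * (|c| ^ p * (ε * (n : ℝ) ^ (δ / 2) * σ₁ ^ p) / (n : ℝ) ^ p) := by
          gcongr
          exact hL.moment_resid
      _ = ε * (n * ((|c| * σ₁) ^ p * (n : ℝ) ^ (δ / 2) / (n : ℝ) ^ p)) := by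
          rw [Real.mul_rpow (abs_nonneg _) h1.le]; ring
      _ ≤ _ := by gcongr
  have key2 : N * (|c| ^ p * W / N ^ p) ≤ ε * ((|c| * σ₂) ^ 2 / N) := by
    calc N * (|c| ^ p * W / N ^ p)
        ≤ N * (|c| ^ p * (ε * (n : ℝ) ^ (δ / 2) * σ₂ ^ p) / N ^ p) := by
          gcongr
          exact hL.moment_cmean
      _ = ε * (N * ((|c| * σ₂) ^ p * (n : ℝ) ^ (δ / 2) / N ^ p)) := by
          rw [Real.mul_rpow (abs_nonneg _) h2.le]; ring
      _ ≤ _ := by gcongr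
  have h2p : (1 : ℝ) ≤ 2 ^ p := Real.one_le_rpow (by norm_num) hp.le
  set x := |c| ^ p * W / N ^ p with hx
  have hx0 : 0 ≤ x := by positivity
  calc n * ∫ q, |c * (resid f g q / n + cmean P f g q / N)| ^ p ∂P + m * x
      ≤ n * (2 ^ p * (|c| ^ p * R / (n : ℝ) ^ p + x)) + m * (2 ^ p * x) := by
        gcongr
        exact le_mul_of_one_le_left hx0 h2p
    _ = 2 ^ p * (n * (|c| ^ p * R / (n : ℝ) ^ p) + N * x) := by rw [hN]; ring
    _ ≤ 2 ^ p * (ε * ((|c| * σ₁) ^ 2 / n) + ε * ((|c| * σ₂) ^ 2 / N)) := by gcongr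
    _ = _ := by ring

variable [IsProbabilityMeasure P]

lemma nearNormal_meanEst (hL : LyapunovFeature P f g σ₁ σ₂ δ ε n) (hf : Measurable f)
    (hg : Measurable g) (hδ : 0 < δ) (hε : 0 ≤ ε) (hn : 0 < n) (m : ℕ) {τ : ℝ} (hτ : 0 < τ) :
    NearNormal ((Measure.pi fun _ : Fin n => P).prod (Measure.pi fun _ : Fin m => P.snd))
      (fun d => meanEst f g d.1 d.2 - popMean P f) (σ₁ ^ 2 / n + σ₂ ^ 2 / (n + m))
      (τ + τ ^ (-δ) * (2 ^ (2 + δ) * ε) + (∫ y, |y| ^ 3 ∂(gaussianReal 0 1)) / √n) := by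
  intro h K hh hK c hc
  have hmom := hL.moment_sum_le hδ hε hn m hc
  have hn' : (0 : ℝ) < n := by exact_mod_cast hn
  set N : ℝ := (n : ℝ) + m with hN
  have hNpos : (0 : ℝ) < N := by positivity
  set s := c ^ 2 * (σ₁ ^ 2 / n + σ₂ ^ 2 / N) with hs
  set c3 := ∫ y, |y| ^ 3 ∂(gaussianReal 0 1)
  have hc3 : 0 ≤ c3 := integral_nonneg fun _ => by positivity
  -- the contributions of a labeled and of an unlabeled observation, with variances `vL` and `vU`
  set φL : 𝒳 × 𝒱 → ℝ := fun p => c * (resid f g p / n + cmean P f g p / N) with hφL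
  set φU : 𝒱 → ℝ := fun v => c * ((g v - popMean P f) / N) with hφU
  have mL : Measurable φL := by fun_prop
  have mU : Measurable φU := by fun_prop
  set vL : NNReal := (c ^ 2 * (σ₁ ^ 2 / n ^ 2 + σ₂ ^ 2 / N ^ 2)).toNNReal with hvL
  set vU : NNReal := (c ^ 2 * (σ₂ ^ 2 / N ^ 2)).toNNReal with hvU
  have evL : (vL : ℝ) = c ^ 2 * (σ₁ ^ 2 / n ^ 2 + σ₂ ^ 2 / N ^ 2) :=
    Real.coe_toNNReal _ (by positivity)
  have evU : (vU : ℝ) = c ^ 2 * (σ₂ ^ 2 / N ^ 2) := Real.coe_toNNReal _ (by positivity)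
  have hsum : n * (vL : ℝ) + m * vU = s := by
    rw [evL, evU, hs]
    have : (m : ℝ) = N - n := by rw [hN]; ring
    rw [this]
    field_simp
    ring
  have hN1 : N * (vU : ℝ) ≤ s := by
    rw [evU, hs]
    calc N * (c ^ 2 * (σ₂ ^ 2 / N ^ 2)) = c ^ 2 * (σ₂ ^ 2 / N) := by field_simp
      _ ≤ _ := by
        gcongr
        exact le_add_of_nonneg_left (by positivity)
  have hnN : (n : ℝ) ≤ N := by rw [hN]; exact le_add_of_nonneg_right (Nat.cast_nonneg _)
  have hroot : ∀ v : NNReal, n * (v : ℝ) ≤ 1 → √(v : ℝ) ≤ 1 / √n := fun v hv => by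
    rw [← Real.sqrt_one, ← Real.sqrt_div (by norm_num)]
    apply Real.sqrt_le_sqrt
    rw [le_div_iff₀ hn', mul_comm]
    simpa using hv
  have rL : √(vL : ℝ) ≤ 1 / √n := hroot _ <| by
    have : 0 ≤ m * (vU : ℝ) := by positivity
    linarith
  have rU : √(vU : ℝ) ≤ 1 / √n := hroot _ <| by
    have : n * (vU : ℝ) ≤ N * vU := by gcongr
    linarith
  have L2 : MemLp φL 2 P := ((hL.memLp_resid.mul_const (n : ℝ)⁻¹).add
    (hL.memLp_cmean.mul_const N⁻¹)).const_mul c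
  have U2 : MemLp φU 2 P.snd := ((hL.memLp_snd hg).mul_const N⁻¹).const_mul c
  have iR := hL.memLp_resid.integrable (by norm_num)
  have iC := hL.memLp_cmean.integrable (by norm_num)
  have L0 : ∫ p, φL p ∂P = 0 := by
    rw [hφL, integral_const_mul, integral_add (iR.div_const _) (iC.div_const _), integral_div,
      integral_div, hL.integral_resid, hL.integral_cmean]
    simp
  have U0 : ∫ v, φU v ∂P.snd = 0 := by
    rw [integral_snd mU]
    have := hL.integral_cmean
    unfold cmean at this
    simp only [hφU]
    rw [integral_const_mul, integral_div, this]
    simp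
  have Lv : ∫ p, φL p ^ 2 ∂P = vL := by
    have e : ∀ p, φL p ^ 2 = c ^ 2 / n ^ 2 * resid f g p ^ 2
        + 2 * c ^ 2 / (n * N) * (resid f g p * cmean P f g p)
        + c ^ 2 / N ^ 2 * cmean P f g p ^ 2 := fun p => by
      simp only [hφL]
      field_simp
      ring
    have i1 := hL.memLp_resid.integrable_sq.const_mul (c ^ 2 / n ^ 2)
    have i2 : Integrable (fun p => 2 * c ^ 2 / (n * N) * (resid f g p * cmean P f g p)) P :=
      (hL.memLp_resid.integrable_mul hL.memLp_cmean).const_mul _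
    have i3 := hL.memLp_cmean.integrable_sq.const_mul (c ^ 2 / N ^ 2)
    have i12 : Integrable (fun p => c ^ 2 / n ^ 2 * resid f g p ^ 2
        + 2 * c ^ 2 / (n * N) * (resid f g p * cmean P f g p)) P := i1.add i2
    simp only [e]
    rw [integral_add i12 i3, integral_add i1 i2, integral_const_mul, integral_const_mul,
      integral_const_mul, hL.integral_mul, hL.integral_resid_sq, hL.integral_cmean_sq, evL]
    ring
  have Uv : ∫ v, φU v ^ 2 ∂P.snd = vU := by
    rw [integral_snd (F := fun v => φU v ^ 2) (by fun_prop)]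
    have := hL.integral_cmean_sq
    unfold cmean at this
    simp only [hφU, mul_pow, div_pow]
    rw [integral_const_mul, integral_div, this, evU]
  have Lp : Integrable (fun p => |φL p| ^ (2 + δ)) P := by
    have i1 := hL.integrable_resid.const_mul (2 ^ (2 + δ) * |c / n| ^ (2 + δ))
    have i2 := hL.integrable_cmean.const_mul (2 ^ (2 + δ) * |c / N| ^ (2 + δ))
    refine (i1.add i2).mono' (mL.abs.pow_const _).aestronglyMeasurable (Eventually.of_forall fun p => ?_)
    rw [Real.norm_of_nonneg (by positivity)]
    have := abs_add_rpow_le (by linarith : 0 ≤ 2 + δ) (c / n * resid f g p) (c / N * cmean P f g p)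
    rw [abs_mul, abs_mul, Real.mul_rpow (abs_nonneg _) (abs_nonneg _),
      Real.mul_rpow (abs_nonneg _) (abs_nonneg _)] at this
    have e : φL p = c / n * resid f g p + c / N * cmean P f g p := by simp only [hφL]; ring
    rw [e]
    refine this.trans_eq ?_
    simp only [Pi.add_apply]
    ring
  have Up : Integrable (fun v => |φU v| ^ (2 + δ)) P.snd := by
    refine ((hL.integrable_snd hg).const_mul (|c / N| ^ (2 + δ))).congr
      (Eventually.of_forall fun v => ?_)
    show |c / N| ^ (2 + δ) * |g v - popMean P f| ^ (2 + δ) = |φU v| ^ (2 + δ)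
    rw [← Real.mul_rpow (abs_nonneg _) (abs_nonneg _), ← abs_mul]
    congr 2
    simp only [hφU]
    ring
  have cL := (closeOn_map_gaussianReal hh hK hτ hδ mL L2 L0 Lv Lp).pi_sum hh mL n
  have cU := (closeOn_map_gaussianReal hh hK hτ hδ mU U2 U0 Uv Up).pi_sum hh mU m
  have sL : Measurable fun x : Fin n → 𝒳 × 𝒱 => ∑ i, φL (x i) := by fun_prop
  have sU : Measurable fun x : Fin m → 𝒱 => ∑ i, φU (x i) := by fun_prop
  have := Measure.isProbabilityMeasure_map (μ := Measure.pi fun _ : Fin n => P) sL.aemeasurable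
  have := Measure.isProbabilityMeasure_map (μ := Measure.pi fun _ : Fin m => P.snd)
    sU.aemeasurable
  have cc := cL.conv hh cU
  rw [← map_prod_add sL sU, gaussianReal_conv_gaussianReal] at cc
  have eA : (fun d : (Fin n → 𝒳 × 𝒱) × (Fin m → 𝒱) => c * (meanEst f g d.1 d.2 - popMean P f))
      = fun d => ∑ i, φL (d.1 i) + ∑ j, φU (d.2 j) := by
    funext d
    rw [meanEst_sub_popMean hn, mul_add, Finset.mul_sum, Finset.mul_sum]
  have ev : (n : NNReal) * vL + m * vU = s.toNNReal := by
    ext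
    rw [Real.coe_toNNReal _ (by rw [hs]; positivity), ← hsum]
    push_cast
    ring
  rw [eA, ← ev]
  rw [add_zero] at cc
  refine cc.mono ?_
  rw [integral_snd (F := fun v => |φU v| ^ (2 + δ)) (mU.abs.pow_const _)]
  have hmom' : n * ∫ p, |φL p| ^ (2 + δ) ∂P + m * ∫ p : 𝒳 × 𝒱, |φU p.2| ^ (2 + δ) ∂P
      ≤ 2 ^ (2 + δ) * ε * s := hmom
  set IL := ∫ p, |φL p| ^ (2 + δ) ∂P
  set IU := ∫ p : 𝒳 × 𝒱, |φU p.2| ^ (2 + δ) ∂P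
  have hτδ : 0 < τ ^ (-δ) := by positivity
  calc n * (K * (τ * vL + τ ^ (-δ) * IL + c3 * (vL * √vL)))
        + m * (K * (τ * vU + τ ^ (-δ) * IU + c3 * (vU * √vU)))
      ≤ n * (K * (τ * vL + τ ^ (-δ) * IL + c3 * (vL * (1 / √n))))
        + m * (K * (τ * vU + τ ^ (-δ) * IU + c3 * (vU * (1 / √n)))) := by gcongr
    _ = K * (τ * (n * vL + m * vU) + τ ^ (-δ) * (n * IL + m * IU)
        + c3 / √n * (n * vL + m * vU)) := by ring
    _ ≤ K * (τ * s + τ ^ (-δ) * (2 ^ (2 + δ) * ε * s) + c3 / √n * s) := by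
      rw [hsum]
      gcongr
    _ = _ := by ring

end LyapunovFeature

end OneSample

/-! ### Consistency of the variance estimators -/

/-- `V` estimates `v` with relative error at most `κ` in mean. -/
structure RelConsistent {D : Type*} [MeasurableSpace D] (ρ : Measure D) (V : D → ℝ) (v κ : ℝ) :
    Prop where
  integrable : Integrable V ρ
  bound : ∫ d, |V d - v| ∂ρ ≤ κ * v

lemma RelConsistent.mono {D : Type*} [MeasurableSpace D] {ρ : Measure D} {V : D → ℝ} {v κ κ' : ℝ}
    (h : RelConsistent ρ V v κ) (hv : 0 ≤ v) (hκ : κ ≤ κ') : RelConsistent ρ V v κ' :=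
  ⟨h.integrable, h.bound.trans (by gcongr)⟩

lemma integral_prod_fst_add_snd {D D' : Type*} [MeasurableSpace D] [MeasurableSpace D']
    {ρ : Measure D} {ρ' : Measure D'} [IsProbabilityMeasure ρ] [IsProbabilityMeasure ρ']
    {F : D → ℝ} {G : D' → ℝ} (hF : Integrable F ρ) (hG : Integrable G ρ') :
    ∫ d, (F d.1 + G d.2) ∂(ρ.prod ρ') = ∫ d, F d ∂ρ + ∫ d, G d ∂ρ' := by
  rw [integral_add (hF.comp_fst ρ') (hG.comp_snd ρ), integral_fun_fst, integral_fun_snd]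
  simp

/-- The sum of squares around the average, in terms of deviations from an arbitrary center. -/
lemma sum_sub_average_sq {n m : ℕ} (hn : 0 < n) (x : Fin n → ℝ) (y : Fin m → ℝ) (μ : ℝ) :
    ∑ i, (x i - (∑ i, x i + ∑ j, y j) / (n + m)) ^ 2
        + ∑ j, (y j - (∑ i, x i + ∑ j, y j) / (n + m)) ^ 2
      = ∑ i, (x i - μ) ^ 2 + ∑ j, (y j - μ) ^ 2
        - (∑ i, (x i - μ) + ∑ j, (y j - μ)) ^ 2 / (n + m) := by
  have hn' : (0 : ℝ) < n := by exact_mod_cast hn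
  have hN : (0 : ℝ) < n + m := by positivity
  simp only [sub_sq, Finset.sum_add_distrib, Finset.sum_sub_distrib, Finset.sum_const,
    Finset.card_univ, Fintype.card_fin, nsmul_eq_mul, ← Finset.mul_sum, ← Finset.sum_mul]
  field_simp
  ring

section OneSample

variable {𝒳 𝒱 : Type*} [MeasurableSpace 𝒳] [MeasurableSpace 𝒱] {P : Measure (𝒳 × 𝒱)}
  {f : 𝒳 → ℝ} {g : 𝒱 → ℝ} {σ₁ σ₂ δ ε : ℝ} {n m : ℕ}

/-- The error of `σ̂²` in terms of centered sums of squares; the last term is the price of centering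
at the sample average. -/
lemma sigmaSqEst_sub (hn : 0 < n) (L : Fin n → 𝒳 × 𝒱) (U : Fin m → 𝒱) :
    sigmaSqEst f g L U - (σ₁ ^ 2 / n + σ₂ ^ 2 / (n + m)) =
      (∑ i, (resid f g (L i) ^ 2 - σ₁ ^ 2)) / (n : ℝ) ^ 2
        + (∑ i, (cmean P f g (L i) ^ 2 - σ₂ ^ 2)
          + ∑ j, ((g (U j) - popMean P f) ^ 2 - σ₂ ^ 2)) / ((n : ℝ) + m) ^ 2
        - (∑ i, cmean P f g (L i) + ∑ j, (g (U j) - popMean P f)) ^ 2 / ((n : ℝ) + m) ^ 3 := by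
  have hn' : (0 : ℝ) < n := by exact_mod_cast hn
  have hN : (0 : ℝ) < n + m := by positivity
  have key := sum_sub_average_sq hn (fun i => g (L i).2) (fun j => g (U j)) (popMean P f)
  simp only [sigmaSqEst, sigma1SqEst, sigma2SqEst, covMean, key, resid, cmean,
    Finset.sum_sub_distrib (f := fun i => (f (L i).1 - g (L i).2) ^ 2),
    Finset.sum_sub_distrib (f := fun i => (g (L i).2 - popMean P f) ^ 2),
    Finset.sum_sub_distrib (f := fun j => (g (U j) - popMean P f) ^ 2),
    Finset.sum_const, Finset.card_univ, Fintype.card_fin, nsmul_eq_mul]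
  field_simp
  ring

lemma sampleVar_div_sub (hn : 2 ≤ n) (L : Fin n → 𝒳 × 𝒱) (s : ℝ) :
    sampleVar f L / n - s / n =
      ((∑ i, ((f (L i).1 - popMean P f) ^ 2 - s)) + s
        - (∑ i, (f (L i).1 - popMean P f)) ^ 2 / n) / ((n - 1) * n) := by
  have hn' : (2 : ℝ) ≤ n := by exact_mod_cast hn
  have hn0 : (n : ℝ) ≠ 0 := by linarith
  have hn1 : (n : ℝ) - 1 ≠ 0 := by linarith
  have key := sum_sub_average_sq (n := n) (m := 0) (by omega) (fun i => f (L i).1) (fun _ => 0)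
    (popMean P f)
  simp only [Finset.univ_eq_empty, Finset.sum_empty, add_zero, Nat.cast_zero] at key
  simp only [sampleVar, sampleMean, key,
    Finset.sum_sub_distrib (f := fun i => (f (L i).1 - popMean P f) ^ 2),
    Finset.sum_const, Finset.card_univ, Fintype.card_fin, nsmul_eq_mul]
  field_simp
  ring

namespace LyapunovFeature

variable [IsProbabilityMeasure P]

lemma relConsistent_sigmaSqEst (hL : LyapunovFeature P f g σ₁ σ₂ δ ε n) (hf : Measurable f)
    (hg : Measurable g) (hδ : 0 < δ) (hε : 0 ≤ ε) (hn : 0 < n) (m : ℕ) {τ : ℝ} (hτ : 0 < τ) :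
    RelConsistent ((Measure.pi fun _ : Fin n => P).prod (Measure.pi fun _ : Fin m => P.snd))
      (fun d => sigmaSqEst f g d.1 d.2) (σ₁ ^ 2 / n + σ₂ ^ 2 / (n + m))
      (2 * (τ + 2 * τ ^ (-δ) * ε) + 2 / n) := by
  have hn' : (0 : ℝ) < n := by exact_mod_cast hn
  have h1 := hL.pos₁
  have h2 := hL.pos₂
  set N : ℝ := (n : ℝ) + m with hN
  have hNpos : (0 : ℝ) < N := by positivity
  set κ := τ + 2 * τ ^ (-δ) * ε with hκ
  have hκ0 : 0 ≤ κ := by positivity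
  set ρL := Measure.pi fun _ : Fin n => P
  set ρU := Measure.pi fun _ : Fin m => P.snd
  set φU : 𝒱 → ℝ := fun v => g v - popMean P f with hφU
  have mU : Measurable φU := by fun_prop
  have U2 : MemLp φU 2 P.snd := hL.memLp_snd hg
  have eU2 : ∫ v, φU v ^ 2 ∂P.snd = σ₂ ^ 2 := by
    rw [integral_snd (F := fun v => φU v ^ 2) (by fun_prop)]
    exact hL.integral_cmean_sq
  have eU0 : ∫ v, φU v ∂P.snd = 0 := by
    rw [integral_snd mU]
    exact hL.integral_cmean
  have hmomN : ∫ p, |cmean P f g p| ^ (2 + δ) ∂P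
      ≤ ε * ((n + m : ℕ) : ℝ) ^ (δ / 2) * σ₂ ^ (2 + δ) := by
    refine hL.moment_cmean.trans ?_
    have : (n : ℝ) ≤ ((n + m : ℕ) : ℝ) := by push_cast; rw [← hN]; linarith [m.cast_nonneg (α := ℝ)]
    gcongr
  have hmomU : ∫ v, |φU v| ^ (2 + δ) ∂P.snd
      ≤ ε * ((n + m : ℕ) : ℝ) ^ (δ / 2) * σ₂ ^ (2 + δ) := by
    rw [integral_snd (F := fun v => |φU v| ^ (2 + δ)) (mU.abs.pow_const _)]
    exact hmomN
  have b1 : ∫ x, |∑ i, (resid f g (x i) ^ 2 - σ₁ ^ 2)| ∂ρL ≤ κ * (n * σ₁ ^ 2) :=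
    integral_abs_sum_sq_sub_le_of_moment (measurable_resid hf hg) hL.memLp_resid hδ h1 hτ
      hL.integral_resid_sq hL.integrable_resid hn le_rfl hL.moment_resid
  have b2 : ∫ x, |∑ i, (cmean P f g (x i) ^ 2 - σ₂ ^ 2)| ∂ρL ≤ κ * (N * σ₂ ^ 2) := by
    have := integral_abs_sum_sq_sub_le_of_moment (n := n) (N := n + m) (measurable_cmean hg)
      hL.memLp_cmean hδ h2 hτ hL.integral_cmean_sq hL.integrable_cmean (by omega) (by omega) hmomN
    push_cast at this
    exact this
  have b3 : ∫ x, |∑ j, (φU (x j) ^ 2 - σ₂ ^ 2)| ∂ρU ≤ κ * (N * σ₂ ^ 2) := by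
    have := integral_abs_sum_sq_sub_le_of_moment (n := m) (N := n + m) mU
      U2 hδ h2 hτ eU2 (hL.integrable_snd hg) (by omega) (by omega) hmomU
    push_cast at this
    exact this
  have b4 : ∫ x, (∑ i, cmean P f g (x i)) ^ 2 ∂ρL = n * σ₂ ^ 2 := by
    rw [integral_sq_sum_pi hL.memLp_cmean hL.integral_cmean, hL.integral_cmean_sq]
  have b5 : ∫ x, (∑ j, φU (x j)) ^ 2 ∂ρU = m * σ₂ ^ 2 := by
    rw [integral_sq_sum_pi U2 eU0, eU2]
  have iF : ∀ {F : (Fin n → 𝒳 × 𝒱) → ℝ}, Integrable F ρL →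
      Integrable (fun d : (Fin n → 𝒳 × 𝒱) × (Fin m → 𝒱) => F d.1) (ρL.prod ρU) :=
    fun h => h.comp_fst ρU
  have iS : ∀ {F : (Fin m → 𝒱) → ℝ}, Integrable F ρU →
      Integrable (fun d : (Fin n → 𝒳 × 𝒱) × (Fin m → 𝒱) => F d.2) (ρL.prod ρU) :=
    fun h => h.comp_snd ρL
  have i1 : Integrable (fun x : Fin n → 𝒳 × 𝒱 => ∑ i, (resid f g (x i) ^ 2 - σ₁ ^ 2)) ρL :=
    integrable_finsetSum _ fun i _ => integrable_pi_eval (X := fun p => resid f g p ^ 2 - σ₁ ^ 2)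
      (hL.memLp_resid.integrable_sq.sub (integrable_const _)) i
  have i2 : Integrable (fun x : Fin n → 𝒳 × 𝒱 => ∑ i, (cmean P f g (x i) ^ 2 - σ₂ ^ 2)) ρL :=
    integrable_finsetSum _ fun i _ => integrable_pi_eval (X := fun p => cmean P f g p ^ 2 - σ₂ ^ 2)
      (hL.memLp_cmean.integrable_sq.sub (integrable_const _)) i
  have i3 : Integrable (fun x : Fin m → 𝒱 => ∑ j, (φU (x j) ^ 2 - σ₂ ^ 2)) ρU :=
    integrable_finsetSum _ fun i _ => integrable_pi_eval (X := fun p => φU p ^ 2 - σ₂ ^ 2)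
      (U2.integrable_sq.sub (integrable_const _)) i
  have m4 : MemLp (fun x : Fin n → 𝒳 × 𝒱 => ∑ i, cmean P f g (x i)) 2 ρL :=
    memLp_finsetSum _ fun i _ =>
      hL.memLp_cmean.comp_measurePreserving (measurePreserving_eval (fun _ : Fin n => P) i)
  have m5 : MemLp (fun x : Fin m → 𝒱 => ∑ j, φU (x j)) 2 ρU :=
    memLp_finsetSum _ fun i _ =>
      U2.comp_measurePreserving (measurePreserving_eval (fun _ : Fin m => P.snd) i)
  have m45 := (m4.comp_fst ρU).add (m5.comp_snd ρL)
  have hrep := fun d : (Fin n → 𝒳 × 𝒱) × (Fin m → 𝒱) =>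
    sigmaSqEst_sub (P := P) (f := f) (g := g) (σ₁ := σ₁) (σ₂ := σ₂) hn d.1 d.2
  have iD : Integrable (fun d : (Fin n → 𝒳 × 𝒱) × (Fin m → 𝒱) =>
      sigmaSqEst f g d.1 d.2 - (σ₁ ^ 2 / n + σ₂ ^ 2 / N)) (ρL.prod ρU) := by
    simp only [hN, hrep]
    exact (((iF i1).div_const _).add (((iF i2).add (iS i3)).div_const _)).sub
      (m45.integrable_sq.div_const _)
  refine ⟨?_, ?_⟩
  · have := iD.add (integrable_const (σ₁ ^ 2 / n + σ₂ ^ 2 / N))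
    refine this.congr (Eventually.of_forall fun d => ?_)
    simp
  · have ipt : ∀ d : (Fin n → 𝒳 × 𝒱) × (Fin m → 𝒱),
        |sigmaSqEst f g d.1 d.2 - (σ₁ ^ 2 / n + σ₂ ^ 2 / N)|
        ≤ ((fun x : Fin n → 𝒳 × 𝒱 => |∑ i, (resid f g (x i) ^ 2 - σ₁ ^ 2)| / n ^ 2
            + |∑ i, (cmean P f g (x i) ^ 2 - σ₂ ^ 2)| / N ^ 2
            + 2 * (∑ i, cmean P f g (x i)) ^ 2 / N ^ 3) d.1)
          + ((fun x : Fin m → 𝒱 => |∑ j, (φU (x j) ^ 2 - σ₂ ^ 2)| / N ^ 2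
            + 2 * (∑ j, φU (x j)) ^ 2 / N ^ 3) d.2) := by
      intro d
      rw [hrep]
      set A := ∑ i, (resid f g (d.1 i) ^ 2 - σ₁ ^ 2)
      set B := ∑ i, (cmean P f g (d.1 i) ^ 2 - σ₂ ^ 2)
      set C := ∑ j, ((g (d.2 j) - popMean P f) ^ 2 - σ₂ ^ 2)
      set a := ∑ i, cmean P f g (d.1 i)
      set b := ∑ j, (g (d.2 j) - popMean P f)
      show |A / n ^ 2 + (B + C) / N ^ 2 - (a + b) ^ 2 / N ^ 3|
        ≤ |A| / n ^ 2 + |B| / N ^ 2 + 2 * a ^ 2 / N ^ 3 + (|C| / N ^ 2 + 2 * b ^ 2 / N ^ 3)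
      calc _ ≤ |A / n ^ 2 + (B + C) / N ^ 2| + |(a + b) ^ 2 / N ^ 3| := abs_sub _ _
        _ ≤ |A| / n ^ 2 + (|B| + |C|) / N ^ 2 + (a + b) ^ 2 / N ^ 3 := by
            rw [abs_of_nonneg (by positivity : 0 ≤ (a + b) ^ 2 / N ^ 3)]
            refine add_le_add ((abs_add_le _ _).trans ?_) le_rfl
            rw [abs_div, abs_div, abs_of_pos (by positivity : 0 < (n : ℝ) ^ 2),
              abs_of_pos (by positivity : 0 < N ^ 2)]
            gcongr
            exact abs_add_le _ _
        _ ≤ |A| / n ^ 2 + (|B| + |C|) / N ^ 2 + 2 * (a ^ 2 + b ^ 2) / N ^ 3 := by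
            gcongr
            nlinarith [sq_nonneg (a - b)]
        _ = _ := by ring
    have j1 := i1.abs.div_const ((n : ℝ) ^ 2)
    have j2 := i2.abs.div_const (N ^ 2)
    have j3 := i3.abs.div_const (N ^ 2)
    have j4 := (m4.integrable_sq.const_mul 2).div_const (N ^ 3)
    have j5 := (m5.integrable_sq.const_mul 2).div_const (N ^ 3)
    have j12 : Integrable (fun x : Fin n → 𝒳 × 𝒱 => |∑ i, (resid f g (x i) ^ 2 - σ₁ ^ 2)| / n ^ 2
      + |∑ i, (cmean P f g (x i) ^ 2 - σ₂ ^ 2)| / N ^ 2) ρL := j1.add j2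
    have j124 : Integrable (fun x : Fin n → 𝒳 × 𝒱 =>
        |∑ i, (resid f g (x i) ^ 2 - σ₁ ^ 2)| / n ^ 2
          + |∑ i, (cmean P f g (x i) ^ 2 - σ₂ ^ 2)| / N ^ 2
          + 2 * (∑ i, cmean P f g (x i)) ^ 2 / N ^ 3) ρL := j12.add j4
    have j35 : Integrable (fun x : Fin m → 𝒱 => |∑ j, (φU (x j) ^ 2 - σ₂ ^ 2)| / N ^ 2
          + 2 * (∑ j, φU (x j)) ^ 2 / N ^ 3) ρU := j3.add j5
    refine ((integral_mono iD.abs ((iF j124).add (iS j35)) ipt).trans_eq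
      (integral_prod_fst_add_snd j124 j35)).trans ?_
    rw [integral_add j12 j4, integral_add j1 j2, integral_add j3 j5, integral_div, integral_div,
      integral_div, integral_div, integral_div, integral_const_mul, integral_const_mul, b4, b5]
    have hNn : 1 / N ≤ 1 / n := by
      apply one_div_le_one_div_of_le hn'
      rw [hN]; linarith [m.cast_nonneg (α := ℝ)]
    calc _ ≤ κ * (n * σ₁ ^ 2) / n ^ 2 + κ * (N * σ₂ ^ 2) / N ^ 2 + 2 * (n * σ₂ ^ 2) / N ^ 3
          + (κ * (N * σ₂ ^ 2) / N ^ 2 + 2 * (m * σ₂ ^ 2) / N ^ 3) := by gcongr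
      _ = κ * (σ₁ ^ 2 / n) + 2 * κ * (σ₂ ^ 2 / N) + 2 * (1 / N) * (σ₂ ^ 2 / N) := by
          have : (m : ℝ) = N - n := by rw [hN]; ring
          rw [this]
          field_simp
          ring
      _ ≤ (2 * κ + 2 * (1 / n)) * (σ₁ ^ 2 / n) + 2 * κ * (σ₂ ^ 2 / N)
          + 2 * (1 / n) * (σ₂ ^ 2 / N) := by
          have : 0 ≤ 2 * (1 / (n : ℝ)) := by positivity
          gcongr
          linarith
      _ = _ := by ring

lemma relConsistent_sampleVar (hL : LyapunovFeature P f g σ₁ σ₂ δ ε n) (hf : Measurable f)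
    (hδ : 0 < δ) (hε : 0 ≤ ε) (hn : 2 ≤ n) {τ : ℝ} (hτ : 0 < τ) :
    RelConsistent (Measure.pi fun _ : Fin n => P) (fun L => sampleVar f L / n)
      ((σ₁ ^ 2 + σ₂ ^ 2) / n) (2 * (τ + 2 * τ ^ (-δ) * ε) + 4 / n) := by
  have hn' : (2 : ℝ) ≤ n := by exact_mod_cast hn
  have hn0 : (0 : ℝ) < n := by linarith
  have hn1 : (0 : ℝ) < n - 1 := by linarith
  have h1 := hL.pos₁
  have h2 := hL.pos₂
  set κ := τ + 2 * τ ^ (-δ) * ε with hκ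
  have hκ0 : 0 ≤ κ := by positivity
  set s := σ₁ ^ 2 + σ₂ ^ 2 with hs
  have hs0 : 0 < s := by positivity
  set ρL := Measure.pi fun _ : Fin n => P
  set C : 𝒳 × 𝒱 → ℝ := fun p => f p.1 - popMean P f with hC
  have hCe : ∀ p, C p = resid f g p + cmean P f g p := fun p => by
    simp only [hC, resid, cmean]; ring
  have C2 : MemLp C 2 P := by
    rw [show C = resid f g + cmean P f g from funext hCe]
    exact hL.memLp_resid.add hL.memLp_cmean
  have C0 : ∫ p, C p ∂P = 0 := by
    simp only [hCe]
    rw [integral_add (hL.memLp_resid.integrable (by norm_num))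
      (hL.memLp_cmean.integrable (by norm_num)), hL.integral_resid, hL.integral_cmean, add_zero]
  have Csq : ∫ p, C p ^ 2 ∂P = s := by
    have i2 : Integrable (fun p => 2 * (resid f g p * cmean P f g p)) P :=
      (hL.memLp_resid.integrable_mul hL.memLp_cmean).const_mul 2
    have i12 : Integrable (fun p => resid f g p ^ 2 + 2 * (resid f g p * cmean P f g p)) P :=
      hL.memLp_resid.integrable_sq.add i2
    have e : ∀ p, C p ^ 2 = resid f g p ^ 2 + 2 * (resid f g p * cmean P f g p)
        + cmean P f g p ^ 2 := fun p => by rw [hCe]; ring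
    simp only [e]
    rw [integral_add i12 hL.memLp_cmean.integrable_sq,
      integral_add hL.memLp_resid.integrable_sq i2, integral_const_mul, hL.integral_mul,
      hL.integral_resid_sq, hL.integral_cmean_sq, hs]
    ring
  have hss : √s ^ 2 = s := Real.sq_sqrt hs0.le
  have b1 : ∫ x, |∑ i, (C (x i) ^ 2 - s)| ∂ρL ≤ κ * (n * s) := by
    have := integral_abs_sum_sq_sub_le_of_moment (n := n) (N := n) (σ := √s) (by fun_prop)
      C2 hδ (Real.sqrt_pos.2 hs0) hτ (by rw [hss, Csq]) hL.integrable_total (by omega) le_rfl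
      hL.moment_total
    rwa [hss] at this
  have b2 : ∫ x, (∑ i, C (x i)) ^ 2 ∂ρL = n * s := by
    rw [integral_sq_sum_pi C2 C0, Csq]
  have i1 : Integrable (fun x : Fin n → 𝒳 × 𝒱 => ∑ i, (C (x i) ^ 2 - s)) ρL :=
    integrable_finsetSum _ fun i _ => integrable_pi_eval (X := fun p => C p ^ 2 - s)
      (C2.integrable_sq.sub (integrable_const _)) i
  have m2 : MemLp (fun x : Fin n → 𝒳 × 𝒱 => ∑ i, C (x i)) 2 ρL :=
    memLp_finsetSum _ fun i _ =>
      C2.comp_measurePreserving (measurePreserving_eval (fun _ : Fin n => P) i)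
  have hrep := fun x : Fin n → 𝒳 × 𝒱 => sampleVar_div_sub (P := P) (f := f) hn x s
  have iD : Integrable (fun x : Fin n → 𝒳 × 𝒱 => sampleVar f x / n - s / n) ρL := by
    simp only [hrep]
    exact ((i1.add (integrable_const _)).sub (m2.integrable_sq.div_const _)).div_const _
  refine ⟨?_, ?_⟩
  · refine (iD.add (integrable_const (s / n))).congr (Eventually.of_forall fun d => ?_)
    simp
  · have ipt : ∀ x : Fin n → 𝒳 × 𝒱, |sampleVar f x / n - s / n| ≤
        (|∑ i, (C (x i) ^ 2 - s)| + s + (∑ i, C (x i)) ^ 2 / n) / ((n - 1) * n) := by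
      intro x
      rw [hrep, abs_div, abs_of_pos (by positivity : 0 < ((n : ℝ) - 1) * n)]
      gcongr
      refine (abs_sub _ _).trans (add_le_add ((abs_add_le _ _).trans ?_) ?_)
      · rw [abs_of_pos hs0]
      · rw [abs_of_nonneg (by positivity)]
    have j1 : Integrable (fun x : Fin n → 𝒳 × 𝒱 => |∑ i, (C (x i) ^ 2 - s)| + s) ρL :=
      i1.abs.add (integrable_const _)
    have j2 := m2.integrable_sq.div_const (n : ℝ)
    refine (integral_mono iD.abs ((j1.add j2).div_const _) ipt).trans ?_
    have e : ∫ x, (|∑ i, (C (x i) ^ 2 - s)| + s + (∑ i, C (x i)) ^ 2 / n) / ((n - 1) * n) ∂ρL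
        = (∫ x, |∑ i, (C (x i) ^ 2 - s)| ∂ρL + s + n * s / n) / ((n - 1) * n) := by
      rw [integral_div, integral_add j1 j2, integral_add i1.abs (integrable_const _), integral_div,
        b2]
      simp
    refine e.trans_le ?_
    calc _ ≤ (κ * (n * s) + s + n * s / n) / ((n - 1) * n) := by gcongr
      _ = (κ * n + 2) * (s / n) / (n - 1) := by field_simp; ring
      _ ≤ (κ * n + 2) * (s / n) / (n / 2) := by
          gcongr
          linarith
      _ = _ := by field_simp; ring

end LyapunovFeature

end OneSample

/-! ### The standard normal distribution function -/

lemma gaussianReal_zero_one_le_volume : gaussianReal 0 1 ≤ volume := by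
  rw [gaussianReal_of_var_ne_zero _ one_ne_zero]
  refine (withDensity_mono (g := 1) (Eventually.of_forall fun x => ?_)).trans_eq withDensity_one
  rw [gaussianPDF, Pi.one_apply, ENNReal.ofReal_le_one, gaussianPDFReal]
  have h1 : (1 : ℝ) ≤ √(2 * Real.pi * (1 : NNReal)) := by
    rw [Real.one_le_sqrt]
    push_cast
    nlinarith [Real.pi_gt_three]
  have h2 : Real.exp (-(x - 0) ^ 2 / (2 * (1 : NNReal))) ≤ 1 := by
    rw [Real.exp_le_one_iff]
    exact div_nonpos_of_nonpos_of_nonneg (by nlinarith [sq_nonneg (x - 0)]) (by positivity)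
  exact mul_le_one₀ (inv_le_one_of_one_le₀ h1) (Real.exp_pos _).le h2

lemma normalCDF_eq (x : ℝ) : normalCDF x = (gaussianReal 0 1).real (Set.Iic x) :=
  cdf_eq_real _ x

lemma normalCDF_mono : Monotone normalCDF := monotone_cdf _

lemma normalCDF_nonneg (x : ℝ) : 0 ≤ normalCDF x := cdf_nonneg _ x

lemma normalCDF_le_one (x : ℝ) : normalCDF x ≤ 1 := cdf_le_one _ x

lemma normalCDF_sub {a b : ℝ} (hab : a ≤ b) :
    normalCDF b - normalCDF a = (gaussianReal 0 1).real (Set.Ioc a b) := by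
  rw [normalCDF_eq, normalCDF_eq, ← Set.Iic_union_Ioc_eq_Iic hab,
    measureReal_union (Set.Iic_disjoint_Ioc le_rfl) measurableSet_Ioc]
  ring

lemma normalCDF_sub_le {a b : ℝ} (hab : a ≤ b) : normalCDF b - normalCDF a ≤ b - a := by
  rw [normalCDF_sub hab, measureReal_def]
  refine ENNReal.toReal_le_of_le_ofReal (by linarith) ?_
  refine (gaussianReal_zero_one_le_volume _).trans_eq ?_
  rw [Real.volume_Ioc]

lemma normalCDF_strictMono : StrictMono normalCDF := by
  intro a b hab
  rw [← sub_pos, normalCDF_sub hab.le]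
  refine ENNReal.toReal_pos (fun h => ?_) (measure_ne_top _ _)
  have := gaussianReal_absolutelyContinuous' 0 one_ne_zero h
  rw [Real.volume_Ioc, ENNReal.ofReal_eq_zero] at this
  linarith

lemma continuous_normalCDF : Continuous normalCDF := by
  refine LipschitzWith.continuous (K := 1) (LipschitzWith.of_dist_le_mul fun x y => ?_)
  rw [Real.dist_eq, Real.dist_eq, NNReal.coe_one, one_mul]
  rcases le_total x y with h | h
  · rw [abs_sub_comm, abs_sub_comm x, abs_of_nonneg (sub_nonneg.2 (normalCDF_mono h)),
      abs_of_nonneg (sub_nonneg.2 h)]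
    exact normalCDF_sub_le h
  · rw [abs_of_nonneg (sub_nonneg.2 (normalCDF_mono h)), abs_of_nonneg (sub_nonneg.2 h)]
    exact normalCDF_sub_le h

lemma measurable_normalCDF : Measurable normalCDF := continuous_normalCDF.measurable

lemma gaussianReal_real_Ioi (x : ℝ) : (gaussianReal 0 1).real (Set.Ioi x) = normalCDF (-x) := by
  have : NullSingletonClass (gaussianReal 0 1) := nullSingletonClass_gaussianReal one_ne_zero
  have e : gaussianReal 0 1 = (gaussianReal 0 1).map (fun y => -y) := by
    rw [gaussianReal_map_neg, neg_zero]
  conv_lhs => rw [e]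
  rw [normalCDF_eq, map_measureReal_apply (by fun_prop) measurableSet_Ioi,
    measureReal_congr Iio_ae_eq_Iic.symm]
  congr 1
  ext y
  simp

lemma gaussianReal_real_Ici (x : ℝ) : (gaussianReal 0 1).real (Set.Ici x) = normalCDF (-x) := by
  have : NullSingletonClass (gaussianReal 0 1) := nullSingletonClass_gaussianReal one_ne_zero
  rw [← gaussianReal_real_Ioi, measureReal_congr Ioi_ae_eq_Ici]

lemma normalCDF_neg (x : ℝ) : normalCDF (-x) = 1 - normalCDF x := by
  rw [← gaussianReal_real_Ioi, normalCDF_eq, ← Set.compl_Iic, probReal_compl_eq_one_sub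
    measurableSet_Iic]

lemma normalCDF_normalQuantile {p : ℝ} (hp : p ∈ Set.Ioo (0 : ℝ) 1) :
    normalCDF (normalQuantile p) = p := by
  obtain ⟨y, hy⟩ : ∃ y, normalCDF y = p := by
    obtain ⟨a, ha⟩ := ((tendsto_cdf_atBot (gaussianReal 0 1)).eventually_lt_const hp.1).exists
    obtain ⟨b, hb⟩ := ((tendsto_cdf_atTop (gaussianReal 0 1)).eventually_const_lt hp.2).exists
    exact mem_range_of_exists_le_of_exists_ge continuous_normalCDF ⟨a, le_of_lt ha⟩
      ⟨b, le_of_lt hb⟩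
  have : {x : ℝ | p ≤ normalCDF x} = Set.Ici y := by
    ext x
    rw [Set.mem_ofPred_eq, ← hy, normalCDF_strictMono.le_iff_le, Set.mem_Ici]
  rw [normalQuantile, this, csInf_Ici, hy]

lemma normalQuantile_one_sub {p : ℝ} (hp : p ∈ Set.Ioo (0 : ℝ) 1) :
    normalQuantile (1 - p) = -normalQuantile p := by
  apply normalCDF_strictMono.injective
  rw [normalCDF_neg, normalCDF_normalQuantile hp,
    normalCDF_normalQuantile ⟨by linarith [hp.2], by linarith [hp.1]⟩]

/-! ### Studentized two-sample statistics -/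

/-- Closeness on a smooth step with transition zone of width `η` controls the tails. -/
lemma abs_measureReal_Ioi_sub_normalCDF_le {h : ℝ → ℝ} {K η d : ℝ} (hh : SmoothTest h K)
    (hη : 0 ≤ η) (h0 : ∀ x, 0 ≤ h x) (h1 : ∀ x, h x ≤ 1) (hz : ∀ x ≤ 0, h x = 0)
    (ho : ∀ x, η ≤ x → h x = 1) {ν : Measure ℝ} [IsProbabilityMeasure ν]
    (hd : CloseOn h ν (gaussianReal 0 1) d) (x : ℝ) :
    |ν.real (Set.Ioi x) - normalCDF (-x)| ≤ η + d := by
  -- translates of `h` lie between indicators of half-lines at distance `η`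
  have up : ∀ (ν : Measure ℝ) [IsProbabilityMeasure ν] (a : ℝ),
      ∫ y, h (a + y) ∂ν ≤ ν.real (Set.Ioi (-a)) := by
    intro ν _ a
    rw [← integral_indicator_one measurableSet_Ioi]
    refine integral_mono (hh.integrable ν a)
      ((integrable_const (1 : ℝ)).indicator measurableSet_Ioi) fun y => ?_
    by_cases hy : y ∈ Set.Ioi (-a)
    · rw [Set.indicator_of_mem hy]
      exact h1 _
    · rw [Set.indicator_of_notMem hy]
      exact (hz _ (by simp only [Set.mem_Ioi, not_lt] at hy; linarith)).le
  have lo : ∀ (ν : Measure ℝ) [IsProbabilityMeasure ν] (a : ℝ),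
      ν.real (Set.Ici (η - a)) ≤ ∫ y, h (a + y) ∂ν := by
    intro ν _ a
    rw [← integral_indicator_one measurableSet_Ici]
    refine integral_mono ((integrable_const (1 : ℝ)).indicator measurableSet_Ici)
      (hh.integrable ν a) fun y => ?_
    by_cases hy : y ∈ Set.Ici (η - a)
    · rw [Set.indicator_of_mem hy]
      exact (ho _ (by simp only [Set.mem_Ici] at hy; linarith)).ge
    · rw [Set.indicator_of_notMem hy]
      exact h0 _
  have d1 := (abs_le.1 (hd (-x))).1
  have d2 := (abs_le.1 (hd (η - x))).2
  have u1 := up ν (-x)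
  have l1 := lo (gaussianReal 0 1) (-x)
  have u2 := up (gaussianReal 0 1) (η - x)
  have l2 := lo ν (η - x)
  rw [gaussianReal_real_Ici] at l1
  rw [gaussianReal_real_Ioi] at u2
  have e : ν.real (Set.Ioi x) ≤ ν.real (Set.Ici (η - (η - x))) :=
    measureReal_mono (by rw [sub_sub_cancel]; exact Set.Ioi_subset_Ici_self)
  rw [neg_neg] at u1
  have L1 := normalCDF_sub_le (show -(η - -x) ≤ -x by linarith)
  have L2 := normalCDF_sub_le (show -x ≤ - -(η - x) by linarith)
  rw [abs_le]
  constructor <;> linarith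

section TwoSample

variable {D D' : Type*} [MeasurableSpace D] [MeasurableSpace D'] {ρ : Measure D} {ρ' : Measure D'}
  [IsProbabilityMeasure ρ] [IsProbabilityMeasure ρ']

/-- The standardized difference of two independent nearly normal variables is nearly standard
normal. -/
lemma NearNormal.closeOn_sub {A : D → ℝ} {A' : D' → ℝ} {v v' κ : ℝ} (hA : Measurable A)
    (hA' : Measurable A') (hv : 0 < v) (hv' : 0 < v') (h1 : NearNormal ρ A v κ)
    (h2 : NearNormal ρ' A' v' κ) {h : ℝ → ℝ} {K : ℝ} (hh : SmoothTest h K) (hK : 0 ≤ K) :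
    CloseOn h ((ρ.prod ρ').map fun d => (A d.1 - A' d.2) / √(v + v')) (gaussianReal 0 1)
      (K * κ) := by
  set s := √(v + v') with hs
  have hs0 : 0 < s := Real.sqrt_pos.2 (by positivity)
  have hss : s ^ 2 = v + v' := Real.sq_sqrt (by positivity)
  have m1 : Measurable fun d => 1 / s * A d := by fun_prop
  have m2 : Measurable fun d => -1 / s * A' d := by fun_prop
  have := Measure.isProbabilityMeasure_map (μ := ρ) m1.aemeasurable
  have := Measure.isProbabilityMeasure_map (μ := ρ') m2.aemeasurable
  have e1 : (1 / s) ^ 2 * v = v / (v + v') := by rw [← hss]; field_simp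
  have e2 : (-1 / s) ^ 2 * v' = v' / (v + v') := by rw [← hss]; field_simp
  have e3 : v / (v + v') + v' / (v + v') = 1 := by field_simp
  have p1 : 0 ≤ v / (v + v') := by positivity
  have p2 : 0 ≤ v' / (v + v') := by positivity
  have c := (h1 h K hh hK (1 / s) (by rw [e1]; linarith)).conv hh
    (h2 h K hh hK (-1 / s) (by rw [e2]; linarith))
  rw [← map_prod_add m1 m2, gaussianReal_conv_gaussianReal, e1, e2, ← Real.toNNReal_add p1 p2, e3,
    Real.toNNReal_one, add_zero] at c
  convert c using 1
  · congr 1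
    funext d
    ring
  · rw [← mul_add, ← mul_add, e3, mul_one]

lemma abs_sqrt_sub_one_le {x : ℝ} (hx : 0 ≤ x) : |√x - 1| ≤ |x - 1| := by
  have h : x - 1 = (√x - 1) * (√x + 1) := by
    nlinarith [Real.sq_sqrt hx]
  rw [h, abs_mul]
  refine le_mul_of_one_le_right (abs_nonneg _) ?_
  rw [abs_of_nonneg (by positivity)]
  linarith [Real.sqrt_nonneg x]

/-- If the variance estimate `V` has relative error at most `r`, then exchanging it for `v` in the
denominator of a statistic turns the critical value `c` into one close to `z`. -/
lemma studentized_threshold {V v r z c κ : ℝ} (hv : 0 < v) (hr : r ≤ 1 / 2)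
    (hc : |c - z| ≤ κ) (hV : |V - v| ≤ r * v) :
    0 < √V ∧ |c * √V / √v - z| ≤ 2 * κ + |z| * r := by
  have hV' := abs_le.1 hV
  have hVpos : 0 < V := by nlinarith
  have hsv : 0 < √v := Real.sqrt_pos.2 hv
  have hq : |√(V / v) - 1| ≤ r := by
    refine (abs_sqrt_sub_one_le (by positivity)).trans ?_
    rw [div_sub_one hv.ne', abs_div, abs_of_pos hv, div_le_iff₀ hv]
    exact hV
  rw [Real.sqrt_div hVpos.le] at hq
  refine ⟨Real.sqrt_pos.2 hVpos, ?_⟩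
  set q := √V / √v with hqd
  have hq2 : |q| ≤ 2 := by
    rw [abs_le] at hq ⊢
    constructor <;> linarith [hq.1, hq.2]
  have hκ : 0 ≤ κ := (abs_nonneg _).trans hc
  calc |c * √V / √v - z| = |(c - z) * q + z * (q - 1)| := by
        congr 1
        rw [hqd]
        ring
    _ ≤ |c - z| * |q| + |z| * |q - 1| := by
        rw [← abs_mul, ← abs_mul]
        exact abs_add_le _ _
    _ ≤ κ * 2 + |z| * r := by gcongr
    _ = _ := by ring

/-- Uniform normal approximation for the rejection probability of a studentized two-sample test,
with an error that does not depend on the shift `Δ`. -/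
lemma abs_studentized_power_sub_le {A V : D → ℝ} {A' V' : D' → ℝ} {v v' κ r z c : ℝ}
    (hA : Measurable A) (hA' : Measurable A') (hv : 0 < v) (hv' : 0 < v')
    (hN : NearNormal ρ A v κ) (hN' : NearNormal ρ' A' v' κ) (hV : RelConsistent ρ V v κ)
    (hV' : RelConsistent ρ' V' v' κ) (hr : 0 < r) (hr2 : r ≤ 1 / 2) (hκ : κ ≤ r ^ 2)
    (hc : |c - z| ≤ κ) {h : ℝ → ℝ} {K η : ℝ} (hK : 0 ≤ K) (hh : SmoothTest h K) (hη : 0 ≤ η)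
    (h0 : ∀ x, 0 ≤ h x) (h1 : ∀ x, h x ≤ 1) (hz : ∀ x ≤ 0, h x = 0)
    (ho : ∀ x, η ≤ x → h x = 1) (Δ : ℝ) :
    |(ρ.prod ρ').real {d | c < (A d.1 - A' d.2 + Δ) / √(V d.1 + V' d.2)}
      - normalCDF (Δ / √(v + v') - z)| ≤ 2 * κ + |z| * r + (η + K * κ) + r := by
  set s := √(v + v') with hs
  have hvv : 0 < v + v' := by positivity
  have hs0 : 0 < s := Real.sqrt_pos.2 hvv
  set Z : D × D' → ℝ := fun d => (A d.1 - A' d.2) / s with hZ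
  have mZ : Measurable Z := by fun_prop
  have := Measure.isProbabilityMeasure_map (μ := ρ.prod ρ') mZ.aemeasurable
  have tail := abs_measureReal_Ioi_sub_normalCDF_le hh hη h0 h1 hz ho
    (hN.closeOn_sub hA hA' hv hv' hN' hh hK)
  set ρρ := ρ.prod ρ'
  set w := 2 * κ + |z| * r with hw
  have hκ0 : 0 ≤ κ := (abs_nonneg _).trans hc
  have hw0 : 0 ≤ w := by positivity
  have tail' : ∀ x, |ρρ.real {d | x < Z d} - normalCDF (-x)| ≤ η + K * κ := fun x => by
    have := tail x
    rwa [map_measureReal_apply mZ measurableSet_Ioi] at this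
  -- the event on which the variance estimate is off
  set B : Set (D × D') := {d | r * (v + v') < |V d.1 + V' d.2 - (v + v')|} with hB
  have iV : Integrable (fun d : D × D' => |V d.1 - v| + |V' d.2 - v'|) ρρ :=
    ((hV.integrable.sub (integrable_const v)).abs.comp_fst ρ').add
      ((hV'.integrable.sub (integrable_const v')).abs.comp_snd ρ)
  have hBle : ρρ.real B ≤ r := by
    have mark := mul_meas_ge_le_integral_of_nonneg
      (Eventually.of_forall fun d => by positivity) iV (r * (v + v'))
    have e := integral_prod_fst_add_snd (hV.integrable.sub (integrable_const v)).abs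
      (hV'.integrable.sub (integrable_const v')).abs
    have e' : ∫ d, (|V d.1 - v| + |V' d.2 - v'|) ∂ρρ ≤ κ * (v + v') := by
      refine e.trans_le ?_
      have a := hV.bound
      have b := hV'.bound
      simp only [Pi.sub_apply]
      linarith
    have sub : B ⊆ {d : D × D' | r * (v + v') ≤ |V d.1 - v| + |V' d.2 - v'|} := by
      intro d hd
      have hd' : r * (v + v') < |V d.1 + V' d.2 - (v + v')| := hd
      refine hd'.le.trans ?_
      rw [show V d.1 + V' d.2 - (v + v') = (V d.1 - v) + (V' d.2 - v') by ring]
      exact abs_add_le _ _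
    have h3 : r * (v + v') * ρρ.real B ≤ κ * (v + v') :=
      le_trans (mul_le_mul_of_nonneg_left (measureReal_mono sub) (by positivity)) (mark.trans e')
    have h4 : r * ρρ.real B ≤ r * r := by
      have : (r * ρρ.real B) * (v + v') ≤ κ * (v + v') := by linarith
      have := le_of_mul_le_mul_right this hvv
      nlinarith
    exact le_of_mul_le_mul_left h4 hr
  have good : ∀ d ∉ B, (c < (A d.1 - A' d.2 + Δ) / √(V d.1 + V' d.2)
      ↔ c * √(V d.1 + V' d.2) / s - Δ / s < Z d) ∧
        |c * √(V d.1 + V' d.2) / s - z| ≤ w := by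
    intro d hd
    have hd' : |V d.1 + V' d.2 - (v + v')| ≤ r * (v + v') := not_lt.1 hd
    obtain ⟨p, q⟩ := studentized_threshold hvv hr2 hc hd'
    refine ⟨?_, q⟩
    rw [lt_div_iff₀ p, ← sub_div]
    simp only [hZ]
    rw [div_lt_div_iff_of_pos_right hs0, sub_lt_iff_lt_add]
  set T : Set (D × D') := {d | c < (A d.1 - A' d.2 + Δ) / √(V d.1 + V' d.2)} with hT
  have up : ρρ.real T ≤ ρρ.real {d | z - w - Δ / s < Z d} + r := by
    have : T ⊆ {d | z - w - Δ / s < Z d} ∪ B := by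
      intro d hd
      by_cases hdB : d ∈ B
      · exact Or.inr hdB
      · obtain ⟨p, q⟩ := good d hdB
        have := p.1 hd
        have := (abs_le.1 q).1
        refine Or.inl ?_
        show z - w - Δ / s < Z d
        linarith
    exact (measureReal_mono this).trans ((measureReal_union_le _ _).trans (by linarith))
  have lo : ρρ.real {d | z + w - Δ / s < Z d} ≤ ρρ.real T + r := by
    have : {d | z + w - Δ / s < Z d} ⊆ T ∪ B := by
      intro d hd
      by_cases hdB : d ∈ B
      · exact Or.inr hdB
      · obtain ⟨p, q⟩ := good d hdB
        have := (abs_le.1 q).2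
        refine Or.inl (p.2 ?_)
        have : z + w - Δ / s < Z d := hd
        linarith
    exact (measureReal_mono this).trans ((measureReal_union_le _ _).trans (by linarith))
  have t1 := (abs_le.1 (tail' (z - w - Δ / s))).2
  have t2 := (abs_le.1 (tail' (z + w - Δ / s))).1
  have l1 := normalCDF_sub_le (show Δ / s - z ≤ -(z - w - Δ / s) by linarith)
  have l2 := normalCDF_sub_le (show -(z + w - Δ / s) ≤ Δ / s - z by linarith)
  rw [abs_le]
  constructor <;> linarith

end TwoSample

/-! ### Rejection probabilities conditionally on the feature -/

lemma NearNormal.mono {D : Type*} [MeasurableSpace D] {ρ : Measure D} {A : D → ℝ} {v κ κ' : ℝ}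
    (h : NearNormal ρ A v κ) (hv : 0 ≤ v) (hκ : κ ≤ κ') : NearNormal ρ A v κ' :=
  fun h' K hh hK c hc => (h h' K hh hK c hc).mono (by gcongr)

lemma meanEst_zero {𝒳 𝒱 : Type*} {n : ℕ} (f : 𝒳 → ℝ) (g : 𝒱 → ℝ) (L : Fin n → 𝒳 × 𝒱) (U : Fin 0 → 𝒱) :
    meanEst f g L U = sampleMean f L := by
  simp only [meanEst, covMean, sampleMean, Finset.univ_eq_empty, Finset.sum_empty, add_zero,
    Nat.cast_zero, Finset.sum_sub_distrib]
  ring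

section Conditional

variable {𝒳 𝒱 : Type*} [MeasurableSpace 𝒳] [MeasurableSpace 𝒱]

/-- The law of one labeled and one unlabeled sample. -/
noncomputable abbrev oneSampleLaw (P : Measure (𝒳 × 𝒱)) (n m : ℕ) :
    Measure ((Fin n → 𝒳 × 𝒱) × (Fin m → 𝒱)) :=
  (Measure.pi fun _ : Fin n => P).prod (Measure.pi fun _ : Fin m => P.snd)

lemma RelConsistent.comp_fst {D D' : Type*} [MeasurableSpace D] [MeasurableSpace D']
    {ρ : Measure D} {V : D → ℝ} {v κ : ℝ} (h : RelConsistent ρ V v κ) (ρ' : Measure D')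
    [SFinite ρ] [IsProbabilityMeasure ρ'] :
    RelConsistent (ρ.prod ρ') (fun d => V d.1) v κ := by
  refine ⟨h.integrable.comp_fst ρ', ?_⟩
  have := integral_fun_fst (μ := ρ) (ν := ρ') (fun d => |V d - v|)
  rw [this]
  simpa using h.bound

/-- Constants for which the error bounds of the one-sample approximations are at most `κ`. -/
lemma exists_error_le {κ δ : ℝ} (hκ : 0 < κ) (hδ : 0 < δ) :
    ∃ ε > 0, ∃ τ > 0, ∀ᶠ n : ℕ in atTop,
      τ + τ ^ (-δ) * (2 ^ (2 + δ) * (2 * 2 ^ (2 + δ) * ε))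
          + (∫ y, |y| ^ 3 ∂(gaussianReal 0 1)) / √n ≤ κ ∧
        2 * (τ + 2 * τ ^ (-δ) * (2 * 2 ^ (2 + δ) * ε)) + 4 / n ≤ κ := by
  set τ := κ / 8 with hτ
  have hτ0 : 0 < τ := by positivity
  set q : ℝ := 2 ^ (2 + δ) with hq
  have hq1 : 1 ≤ q := Real.one_le_rpow (by norm_num) (by linarith)
  have hT : 0 < τ ^ (-δ) := by positivity
  set T := τ ^ (-δ)
  -- with `ε₁ = 2 * q * ε`, the terms are `T * q * ε₁ = κ / 16` and `4 * T * ε₁ = κ / (4 * q)`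
  refine ⟨κ / (32 * T * q * q), by positivity, τ, hτ0, ?_⟩
  have t1 : Tendsto (fun n : ℕ => (∫ y, |y| ^ 3 ∂(gaussianReal 0 1)) / √n) atTop (𝓝 0) :=
    Tendsto.const_div_atTop
      (Real.tendsto_sqrt_atTop.comp tendsto_natCast_atTop_atTop) _
  have t2 : Tendsto (fun n : ℕ => (4 : ℝ) / n) atTop (𝓝 0) :=
    Tendsto.const_div_atTop tendsto_natCast_atTop_atTop _
  filter_upwards [t1.eventually_le_const (by positivity : 0 < κ / 4),
    t2.eventually_le_const (by positivity : 0 < κ / 4)] with n h1 h2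
  have e1 : T * (q * (2 * q * (κ / (32 * T * q * q)))) = κ / 16 := by
    field_simp
    norm_num
  have e2 : 2 * T * (2 * q * (κ / (32 * T * q * q))) = κ / 8 / q := by
    field_simp
    norm_num
  have e3 : κ / 8 / q ≤ κ / 8 := div_le_self (by positivity) hq1
  rw [e1, e2]
  constructor <;> linarith

/-- The one-sample approximations, uniformly over all laws and features that satisfy the moment
condition with a small constant. -/
lemma exists_oneSample_approx {κ δ : ℝ} (hκ : 0 < κ) (hδ : 0 < δ) :
    ∃ ε > 0, ∀ᶠ n : ℕ in atTop, ∀ (m : ℕ) (P : Measure (𝒳 × 𝒱)) [IsProbabilityMeasure P]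
      (f : 𝒳 → ℝ) (g : 𝒱 → ℝ), Measurable f → Measurable g → IsCondMean P f g →
      momentRatio δ P f < ENNReal.ofReal (ε * (n : ℝ) ^ (δ / 2)) →
      0 < sigmaSq n m P f ∧
      NearNormal (oneSampleLaw P n m) (fun d => meanEst f g d.1 d.2 - popMean P f)
        (sigmaSq n m P f) κ ∧
      RelConsistent (oneSampleLaw P n m) (fun d => sigmaSqEst f g d.1 d.2) (sigmaSq n m P f) κ ∧
      RelConsistent (oneSampleLaw P n 0) (fun d => sampleVar f d.1 / n) (sigmaSq n 0 P f) κ := by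
  obtain ⟨ε, hε, τ, hτ, hev⟩ := exists_error_le hκ hδ
  refine ⟨ε, hε, ?_⟩
  filter_upwards [hev, eventually_ge_atTop 2] with n ⟨hn1, hn2⟩ hn m P _ f g hf hg hgf hr
  have hL := LyapunovFeature.of_momentRatio_lt hf hg hgf hδ hr
  have h1 := hL.pos₁
  have h2 := hL.pos₂
  have hn0 : (0 : ℝ) < n := by exact_mod_cast (by omega : 0 < n)
  have hs : ∀ m : ℕ, sigmaSq n m P f
      = √(sigma1Sq P f) ^ 2 / n + √(sigma2Sq P f) ^ 2 / (n + m) := fun m => by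
    rw [← hL.sigma₁, ← hL.sigma₂]
    rfl
  have hpos : ∀ m : ℕ, 0 < sigmaSq n m P f := fun m => by
    rw [hs]
    positivity
  have hpos' := fun m => (hpos m).le
  have hn2' : 2 * (τ + 2 * τ ^ (-δ) * (2 * 2 ^ (2 + δ) * ε)) + 2 / n ≤ κ := by
    have : 2 / (n : ℝ) ≤ 4 / n := by gcongr; norm_num
    linarith
  refine ⟨hpos m, ?_, ?_, ?_⟩
  · refine NearNormal.mono ?_ (hpos' m) hn1
    rw [hs]
    exact hL.nearNormal_meanEst hf hg hδ (by positivity) (by omega) m hτ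
  · refine RelConsistent.mono ?_ (hpos' m) hn2'
    rw [hs]
    exact hL.relConsistent_sigmaSqEst hf hg hδ (by positivity) (by omega) m hτ
  · refine RelConsistent.mono ?_ (hpos' 0) hn2
    rw [hs, Nat.cast_zero, add_zero, ← add_div]
    exact (hL.relConsistent_sampleVar hf hδ (by positivity) hn hτ).comp_fst _

lemma measurable_meanEst {n m : ℕ} {f : 𝒳 → ℝ} {g : 𝒱 → ℝ} (hf : Measurable f)
    (hg : Measurable g) :
    Measurable fun d : (Fin n → 𝒳 × 𝒱) × (Fin m → 𝒱) => meanEst f g d.1 d.2 := by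
  unfold meanEst covMean
  fun_prop

/-- Conditionally on the feature, the rejection probabilities of the oracle test and of the
`t`-test are normal probabilities up to `η`, uniformly over all laws, features and unlabeled
sample sizes. -/
lemma exists_conditional_power_approx {δ η : ℝ} (hδ : 0 < δ) (hη : 0 < η) (z : ℝ) :
    ∃ ε > 0, ∀ᶠ N : ℕ in atTop, ∀ (n₁ m₁ n₂ m₂ : ℕ), N ≤ n₁ → N ≤ n₂ →
      ∀ (P Q : Measure (𝒳 × 𝒱)) [IsProbabilityMeasure P] [IsProbabilityMeasure Q]
      (f : 𝒳 → ℝ) (gX gY : 𝒱 → ℝ), Measurable f → Measurable gX → Measurable gY →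
      IsCondMean P f gX → IsCondMean Q f gY →
      momentRatio δ P f < ENNReal.ofReal (ε * (n₁ : ℝ) ^ (δ / 2)) →
      momentRatio δ Q f < ENNReal.ofReal (ε * (n₂ : ℝ) ^ (δ / 2)) →
      0 < sigmaSq n₁ m₁ P f + sigmaSq n₂ m₂ Q f ∧
      ∀ c, |c - z| ≤ ε →
        |((oneSampleLaw P n₁ m₁).prod (oneSampleLaw Q n₂ m₂)).real
            {d | c < oracleStat f gX gY d.1.1 d.1.2 d.2.1 d.2.2}
          - normalCDF (standardizedShift n₁ m₁ n₂ m₂ P Q f - z)| ≤ η ∧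
        |((oneSampleLaw P n₁ 0).prod (oneSampleLaw Q n₂ 0)).real {d | c < tStat f d.1.1 d.2.1}
          - normalCDF (standardizedShift n₁ 0 n₂ 0 P Q f - z)| ≤ η := by
  obtain ⟨K, hK, h, hh, h0, h1, hz, ho⟩ := exists_smoothTest_step (by positivity : 0 < η / 4)
  set r := min (1 / 2) (η / (4 * (3 + |z| + K))) with hr
  have hr0 : 0 < r := by positivity
  have hr2 : r ≤ 1 / 2 := min_le_left _ _
  have hr3 : (3 + |z| + K) * r ≤ η / 4 := by
    calc (3 + |z| + K) * r ≤ (3 + |z| + K) * (η / (4 * (3 + |z| + K))) := by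
          gcongr
          exact min_le_right _ _
      _ = η / 4 := by field_simp
  have hκr : r ^ 2 ≤ r := by nlinarith
  have herr : 2 * r ^ 2 + |z| * r + (η / 4 + K * r ^ 2) + r ≤ η := by
    have : K * r ^ 2 ≤ K * r := by gcongr
    nlinarith
  obtain ⟨ε, hε, hev⟩ := exists_oneSample_approx (𝒳 := 𝒳) (𝒱 := 𝒱) (pow_pos hr0 2) hδ
  obtain ⟨N₀, hN₀⟩ := eventually_atTop.1 hev
  refine ⟨min ε (r ^ 2), by positivity, eventually_atTop.2 ⟨N₀, ?_⟩⟩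
  intro N hN n₁ m₁ n₂ m₂ hn₁ hn₂ P Q _ _ f gX gY hf hgX hgY hcX hcY hrX hrY
  have mono : ∀ n : ℕ, ENNReal.ofReal (min ε (r ^ 2) * (n : ℝ) ^ (δ / 2))
      ≤ ENNReal.ofReal (ε * (n : ℝ) ^ (δ / 2)) := fun n => by
    apply ENNReal.ofReal_le_ofReal
    gcongr
    exact min_le_left _ _
  have aX := fun m => hN₀ n₁ (hN.trans hn₁) m P f gX hf hgX hcX (hrX.trans_le (mono _))
  have aY := fun m => hN₀ n₂ (hN.trans hn₂) m Q f gY hf hgY hcY (hrY.trans_le (mono _))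
  refine ⟨add_pos (aX m₁).1 (aY m₂).1, fun c hc => ?_⟩
  have hc' : |c - z| ≤ r ^ 2 := hc.trans (min_le_right _ _)
  have mA : ∀ (n m : ℕ) (P : Measure (𝒳 × 𝒱)) (g : 𝒱 → ℝ), Measurable g → Measurable
      fun d : (Fin n → 𝒳 × 𝒱) × (Fin m → 𝒱) => meanEst f g d.1 d.2 - popMean P f :=
    fun n m P g hg => (measurable_meanEst hf hg).sub_const _
  have cancel : ∀ a b x y : ℝ, a - x - (b - y) + (x - y) = a - b := fun a b x y => by ring
  constructor
  · have := abs_studentized_power_sub_le (mA n₁ m₁ P gX hgX) (mA n₂ m₂ Q gY hgY) (aX m₁).1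
      (aY m₂).1 (aX m₁).2.1 (aY m₂).2.1 (aX m₁).2.2.1 (aY m₂).2.2.1 hr0 hr2 le_rfl hc' hK.le hh
      (by positivity) h0 h1 hz ho (popMean P f - popMean Q f)
    simp only [cancel] at this
    exact this.trans herr
  · have := abs_studentized_power_sub_le (mA n₁ 0 P gX hgX) (mA n₂ 0 Q gY hgY) (aX 0).1
      (aY 0).1 (aX 0).2.1 (aY 0).2.1 (aX 0).2.2.2 (aY 0).2.2.2 hr0 hr2 le_rfl hc' hK.le hh
      (by positivity) h0 h1 hz ho (popMean P f - popMean Q f)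
    simp only [cancel, meanEst_zero] at this
    exact this.trans herr

end Conditional

/-! ### Averaging over the feature -/

/-- If, given `ξ`, the probability of an event of independent data is close to `G` off a small
event, then its unconditional probability is close to the mean of `G`. -/
lemma tendsto_measureReal_sub_integral {Ω Θ D : ℕ → Type*} [∀ k, MeasurableSpace (Ω k)]
    [∀ k, MeasurableSpace (Θ k)] [∀ k, MeasurableSpace (D k)] (μ : ∀ k, Measure (Ω k))
    [∀ k, IsProbabilityMeasure (μ k)] (ξ : ∀ k, Ω k → Θ k) (X : ∀ k, Ω k → D k)
    (π : ∀ k, Measure (D k)) [∀ k, IsProbabilityMeasure (π k)]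
    (hlaw : ∀ k, HasLaw (fun ω => (ξ k ω, X k ω)) (((μ k).map (ξ k)).prod (π k)) (μ k))
    (R : ∀ k, Set (Θ k × D k)) (hR : ∀ k, MeasurableSet (R k)) (G : ∀ k, Ω k → ℝ)
    (hGm : ∀ k, AEStronglyMeasurable (G k) (μ k)) (hG0 : ∀ k ω, 0 ≤ G k ω)
    (hG1 : ∀ k ω, G k ω ≤ 1)
    (happrox : ∀ η : ℝ, 0 < η → ∀ᶠ k in atTop, ∃ B : Set (Ω k), μ k B ≤ ENNReal.ofReal η ∧
      ∀ᵐ ω ∂(μ k), ω ∉ B → |(π k).real (Prod.mk (ξ k ω) ⁻¹' R k) - G k ω| ≤ η) :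
    Tendsto (fun k => (μ k).real {ω | (ξ k ω, X k ω) ∈ R k} - ∫ ω, G k ω ∂(μ k)) atTop (𝓝 0) := by
  rw [Metric.tendsto_nhds]
  intro η hη
  filter_upwards [happrox (η / 4) (by positivity)] with k ⟨B, hB, hae⟩
  rw [Real.dist_eq, sub_zero]
  have hξ : AEMeasurable (ξ k) (μ k) := (hlaw k).aemeasurable.fst
  set p : Θ k → ℝ := fun t => (π k).real (Prod.mk t ⁻¹' R k) with hp
  have hpm : Measurable p := (measurable_measure_prodMk_left (hR k)).ennreal_toReal
  have hpi : Integrable (fun ω => p (ξ k ω)) (μ k) :=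
    Integrable.of_bound (C := 1) (hpm.comp_aemeasurable hξ).aestronglyMeasurable
      (Eventually.of_forall fun ω => by
        rw [Real.norm_of_nonneg measureReal_nonneg]; exact measureReal_le_one)
  have hGi : Integrable (G k) (μ k) :=
    Integrable.of_bound (C := 1) (hGm k) (Eventually.of_forall fun ω => by
      rw [Real.norm_of_nonneg (hG0 k ω)]; exact hG1 k ω)
  have e : (μ k).real {ω | (ξ k ω, X k ω) ∈ R k} = ∫ ω, p (ξ k ω) ∂(μ k) := by
    have e1 : (μ k) {ω | (ξ k ω, X k ω) ∈ R k} = (((μ k).map (ξ k)).prod (π k)) (R k) := by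
      rw [← (hlaw k).map_eq, Measure.map_apply_of_aemeasurable (hlaw k).aemeasurable (hR k)]
      rfl
    rw [measureReal_def, e1, Measure.prod_apply (hR k),
      lintegral_map' (measurable_measure_prodMk_left (hR k)).aemeasurable hξ,
      ← integral_toReal (f := fun ω => π k (Prod.mk (ξ k ω) ⁻¹' R k))
        ((measurable_measure_prodMk_left (hR k)).comp_aemeasurable hξ)
        (Eventually.of_forall fun ω => measure_lt_top _ _)]
    rfl
  -- the exceptional event need not be measurable
  set B' := toMeasurable (μ k) B
  have hB' : MeasurableSet B' := measurableSet_toMeasurable _ _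
  have hBr : (μ k).real B' ≤ η / 4 := by
    rw [measureReal_def, measure_toMeasurable]
    exact ENNReal.toReal_le_of_le_ofReal (by positivity) hB
  rw [e, ← integral_sub hpi hGi]
  calc |∫ ω, (p (ξ k ω) - G k ω) ∂(μ k)| ≤ ∫ ω, |p (ξ k ω) - G k ω| ∂(μ k) :=
        abs_integral_le_integral_abs
    _ ≤ ∫ ω, (η / 4 + B'.indicator (fun _ => (1 : ℝ)) ω) ∂(μ k) := by
        refine integral_mono_ae (hpi.sub hGi).abs
          ((integrable_const _).add ((integrable_const _).indicator hB')) ?_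
        filter_upwards [hae] with ω hω
        by_cases hωB : ω ∈ B'
        · simp only [Set.indicator_of_mem hωB]
          have h1 : 0 ≤ p (ξ k ω) := measureReal_nonneg
          have h2 : p (ξ k ω) ≤ 1 := measureReal_le_one
          have h3 := hG0 k ω
          have h4 := hG1 k ω
          rw [abs_le]
          constructor <;> linarith
        · simp only [Set.indicator_of_notMem hωB, add_zero]
          exact hω fun h => hωB (subset_toMeasurable _ _ h)
    _ = η / 4 + (μ k).real B' := by
        rw [integral_add (integrable_const _) ((integrable_const _).indicator hB'),
          integral_indicator_const _ hB']
        simp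
    _ < η := by linarith

/-! ### Measurability in the feature -/

section Measurability

variable {𝒳 𝒱 Θ : Type*} [MeasurableSpace 𝒳] [MeasurableSpace 𝒱] [MeasurableSpace Θ]

lemma measurable_popMean (P : Measure (𝒳 × 𝒱)) [IsProbabilityMeasure P] {f : Θ → 𝒳 → ℝ}
    (hf : Measurable (Function.uncurry f)) : Measurable fun t => popMean P (f t) := by
  have : Measurable (Function.uncurry fun (t : Θ) (p : 𝒳 × 𝒱) => f t p.1) :=
    hf.comp (by fun_prop : Measurable fun q : Θ × (𝒳 × 𝒱) => (q.1, q.2.1))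
  exact this.stronglyMeasurable.integral_prod_right.measurable

/-- Without square integrability, both sides are zero by convention. -/
lemma sigma1Sq_eq_integral {P : Measure (𝒳 × 𝒱)} [IsProbabilityMeasure P] {f : 𝒳 → ℝ}
    {g : 𝒱 → ℝ} (hgf : IsCondMean P f g) :
    sigma1Sq P f = ∫ p, (f p.1 - g p.2) ^ 2 ∂P := by
  have hae : (fun p : 𝒳 × 𝒱 => (f p.1 - P[fun p => f p.1 | covariateAlgebra 𝒳 𝒱] p) ^ 2)
      =ᵐ[P] fun p => (f p.1 - g p.2) ^ 2 := by
    filter_upwards [hgf] with p hp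
    rw [← hp]
  by_cases hi : Integrable (fun p : 𝒳 × 𝒱 =>
      (f p.1 - P[fun p => f p.1 | covariateAlgebra 𝒳 𝒱] p) ^ 2) P
  · rw [sigma1Sq, ← setIntegral_univ,
      setIntegral_condVar (hm := covariateAlgebra_le) hi MeasurableSet.univ, setIntegral_univ]
    exact integral_congr_ae hae
  · rw [sigma1Sq, condVar_of_not_integrable hi]
    rw [integral_undef ((integrable_congr hae).not.1 hi)]
    simp

lemma sigma2Sq_eq_integral {P : Measure (𝒳 × 𝒱)} [IsProbabilityMeasure P] {f : 𝒳 → ℝ}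
    {g : 𝒱 → ℝ} (hg : Measurable g) (hgf : IsCondMean P f g) :
    sigma2Sq P f = ∫ p, (g p.2 - ∫ q, g q.2 ∂P) ^ 2 ∂P := by
  rw [sigma2Sq, ← variance_congr hgf,
    variance_eq_integral (by fun_prop)]

lemma aemeasurable_sigmaSq (n m : ℕ) (P : Measure (𝒳 × 𝒱)) [IsProbabilityMeasure P]
    {f : Θ → 𝒳 → ℝ} {g : Θ → 𝒱 → ℝ} (hf : Measurable (Function.uncurry f))
    (hg : Measurable (Function.uncurry g)) {ν : Measure Θ}
    (hgf : ∀ᵐ t ∂ν, IsCondMean P (f t) (g t)) :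
    AEMeasurable (fun t => sigmaSq n m P (f t)) ν := by
  have hf' : Measurable fun q : Θ × (𝒳 × 𝒱) => f q.1 q.2.1 :=
    hf.comp (by fun_prop : Measurable fun q : Θ × (𝒳 × 𝒱) => (q.1, q.2.1))
  have hg' : Measurable fun q : Θ × (𝒳 × 𝒱) => g q.1 q.2.2 :=
    hg.comp (by fun_prop : Measurable fun q : Θ × (𝒳 × 𝒱) => (q.1, q.2.2))
  have hm : Measurable fun t => ∫ q : 𝒳 × 𝒱, g t q.2 ∂P :=
    (StronglyMeasurable.integral_prod_right (f := fun (t : Θ) (p : 𝒳 × 𝒱) => g t p.2)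
      hg'.stronglyMeasurable).measurable
  have h1 : Measurable fun t => ∫ p : 𝒳 × 𝒱, (f t p.1 - g t p.2) ^ 2 ∂P :=
    (StronglyMeasurable.integral_prod_right
      (f := fun (t : Θ) (p : 𝒳 × 𝒱) => (f t p.1 - g t p.2) ^ 2)
      ((hf'.sub hg').pow_const 2).stronglyMeasurable).measurable
  have h2 : Measurable fun t => ∫ p : 𝒳 × 𝒱, (g t p.2 - ∫ q, g t q.2 ∂P) ^ 2 ∂P :=
    (StronglyMeasurable.integral_prod_right
      (f := fun (t : Θ) (p : 𝒳 × 𝒱) => (g t p.2 - ∫ q, g t q.2 ∂P) ^ 2)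
      ((hg'.sub (hm.comp measurable_fst)).pow_const 2).stronglyMeasurable).measurable
  refine ((h1.div_const (n : ℝ)).add (h2.div_const ((n : ℝ) + m))).aemeasurable.congr ?_
  filter_upwards [hgf] with t ht
  have hgt : Measurable (g t) := hg.comp measurable_prodMk_left
  simp only [sigmaSq, sigma1Sq_eq_integral ht, sigma2Sq_eq_integral hgt ht, Pi.add_apply]

lemma measurable_oracleStat {n₁ m₁ n₂ m₂ : ℕ} {f : Θ → 𝒳 → ℝ} {gX gY : Θ → 𝒱 → ℝ}
    (hf : Measurable (Function.uncurry f)) (hgX : Measurable (Function.uncurry gX))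
    (hgY : Measurable (Function.uncurry gY)) :
    Measurable fun q : Θ × (((Fin n₁ → 𝒳 × 𝒱) × (Fin m₁ → 𝒱)) ×
        ((Fin n₂ → 𝒳 × 𝒱) × (Fin m₂ → 𝒱))) =>
      oracleStat (f q.1) (gX q.1) (gY q.1) q.2.1.1 q.2.1.2 q.2.2.1 q.2.2.2 := by
  unfold oracleStat meanEst sigmaSqEst sigma1SqEst sigma2SqEst covMean
  fun_prop

lemma measurable_tStat {n₁ m₁ n₂ m₂ : ℕ} {f : Θ → 𝒳 → ℝ}
    (hf : Measurable (Function.uncurry f)) :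
    Measurable fun q : Θ × (((Fin n₁ → 𝒳 × 𝒱) × (Fin m₁ → 𝒱)) ×
        ((Fin n₂ → 𝒳 × 𝒱) × (Fin m₂ → 𝒱))) =>
      tStat (f q.1) q.2.1.1 q.2.2.1 := by
  unfold tStat sampleVar sampleMean
  fun_prop

end Measurability

/-! ### Unconditional power -/

lemma integral_sub_integral_le {Ω : Type*} [MeasurableSpace Ω] {μ : Measure Ω}
    [IsProbabilityMeasure μ] {F G : Ω → ℝ} (hF : AEStronglyMeasurable F μ)
    (hG : AEStronglyMeasurable G μ) (hF0 : ∀ ω, 0 ≤ F ω) (hF1 : ∀ ω, F ω ≤ 1)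
    (hG0 : ∀ ω, 0 ≤ G ω) (hG1 : ∀ ω, G ω ≤ 1) {B : Set Ω}
    (h : ∀ᵐ ω ∂μ, ω ∉ B → F ω ≤ G ω) : ∫ ω, F ω ∂μ - ∫ ω, G ω ∂μ ≤ μ.real B := by
  have hFi : Integrable F μ := Integrable.of_bound (C := 1) hF (Eventually.of_forall fun ω => by
    rw [Real.norm_of_nonneg (hF0 ω)]; exact hF1 ω)
  have hGi : Integrable G μ := Integrable.of_bound (C := 1) hG (Eventually.of_forall fun ω => by
    rw [Real.norm_of_nonneg (hG0 ω)]; exact hG1 ω)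
  have hB' : MeasurableSet (toMeasurable μ B) := measurableSet_toMeasurable _ _
  rw [← integral_sub hFi hGi]
  calc ∫ ω, (F ω - G ω) ∂μ ≤ ∫ ω, (toMeasurable μ B).indicator (fun _ => (1 : ℝ)) ω ∂μ := by
        refine integral_mono_ae (hFi.sub hGi) ((integrable_const _).indicator hB') ?_
        filter_upwards [h] with ω hω
        by_cases hωB : ω ∈ toMeasurable μ B
        · simp only [Set.indicator_of_mem hωB]
          linarith [hF1 ω, hG0 ω]
        · simp only [Set.indicator_of_notMem hωB]
          linarith [hω fun h => hωB (subset_toMeasurable _ _ h)]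
    _ = μ.real B := by
        rw [integral_indicator_const _ hB']
        simp [measureReal_def, measure_toMeasurable]

lemma measurePreserving_drop_unlabeled {𝒳 𝒱 : Type*} [MeasurableSpace 𝒳] [MeasurableSpace 𝒱]
    (P : Measure (𝒳 × 𝒱)) [IsProbabilityMeasure P] (n m : ℕ) :
    MeasurePreserving
      (fun d : (Fin n → 𝒳 × 𝒱) × (Fin m → 𝒱) => (d.1, (Fin.elim0 : Fin 0 → 𝒱)))
      (oneSampleLaw P n m) (oneSampleLaw P n 0) := by
  have h : MeasurePreserving (fun _ : Fin m → 𝒱 => (Fin.elim0 : Fin 0 → 𝒱))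
      (Measure.pi fun _ : Fin m => P.snd) (Measure.pi fun _ : Fin 0 => P.snd) := by
    refine ⟨measurable_const, ?_⟩
    rw [Measure.map_const, measure_univ, one_smul]
    exact (Measure.pi_of_empty _ _).symm
  exact (MeasurePreserving.id _).prod h

/-- Discarding the unlabeled observations leaves a sample with `m₁ = m₂ = 0`. -/
lemma IsSemiSupervisedSample.drop_unlabeled {𝒳 𝒱 Ω Θ : Type*} [MeasurableSpace 𝒳]
    [MeasurableSpace 𝒱] [MeasurableSpace Ω] [MeasurableSpace Θ] {μ : Measure Ω}
    [IsProbabilityMeasure μ] {P Q : Measure (𝒳 × 𝒱)} [IsProbabilityMeasure P]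
    [IsProbabilityMeasure Q] {n₁ m₁ n₂ m₂ : ℕ} {ξ : Ω → Θ} {LX : Ω → Fin n₁ → 𝒳 × 𝒱}
    {UV : Ω → Fin m₁ → 𝒱} {LY : Ω → Fin n₂ → 𝒳 × 𝒱} {UW : Ω → Fin m₂ → 𝒱}
    (h : IsSemiSupervisedSample μ P Q ξ LX UV LY UW) :
    IsSemiSupervisedSample μ P Q ξ LX (fun _ => (Fin.elim0 : Fin 0 → 𝒱)) LY
      (fun _ => (Fin.elim0 : Fin 0 → 𝒱)) := by
  have hl : HasLaw (fun ω => (ξ ω, (LX ω, UV ω), (LY ω, UW ω)))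
    ((μ.map ξ).prod ((oneSampleLaw P n₁ m₁).prod (oneSampleLaw Q n₂ m₂))) μ := h
  have hξ : AEMeasurable ξ μ := hl.aemeasurable.fst
  have := Measure.isProbabilityMeasure_map hξ
  exact (((MeasurePreserving.id (μ.map ξ)).prod
    ((measurePreserving_drop_unlabeled P n₁ m₁).prod
      (measurePreserving_drop_unlabeled Q n₂ m₂))).hasLaw).fun_comp hl

lemma sigma2Sq_nonneg {𝒳 𝒱 : Type*} [MeasurableSpace 𝒳] [MeasurableSpace 𝒱]
    (P : Measure (𝒳 × 𝒱)) (f : 𝒳 → ℝ) : 0 ≤ sigma2Sq P f := variance_nonneg _ _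

/-- Unlabeled data reduce the variance. -/
lemma sigmaSq_le_sigmaSq_zero {𝒳 𝒱 : Type*} [MeasurableSpace 𝒳] [MeasurableSpace 𝒱]
    (P : Measure (𝒳 × 𝒱)) (f : 𝒳 → ℝ) {n : ℕ} (hn : 0 < n) (m : ℕ) :
    sigmaSq n m P f ≤ sigmaSq n 0 P f := by
  have := sigma2Sq_nonneg P f
  have : (0 : ℝ) < n := by exact_mod_cast hn
  unfold sigmaSq
  gcongr
  exact Nat.zero_le m

lemma standardizedShift_zero_le {𝒳 𝒱 : Type*} [MeasurableSpace 𝒳] [MeasurableSpace 𝒱]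
    {P Q : Measure (𝒳 × 𝒱)} {f : 𝒳 → ℝ} {n₁ m₁ n₂ m₂ : ℕ} (hn₁ : 0 < n₁) (hn₂ : 0 < n₂)
    (hpos : 0 < sigmaSq n₁ m₁ P f + sigmaSq n₂ m₂ Q f) (hmean : popMean Q f ≤ popMean P f) :
    standardizedShift n₁ 0 n₂ 0 P Q f ≤ standardizedShift n₁ m₁ n₂ m₂ P Q f := by
  unfold standardizedShift
  have h1 := sigmaSq_le_sigmaSq_zero P f hn₁ m₁
  have h2 := sigmaSq_le_sigmaSq_zero Q f hn₂ m₂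
  have h3 : 0 ≤ popMean P f - popMean Q f := by linarith
  gcongr

lemma aemeasurable_standardizedShift {𝒳 𝒱 Θ : Type*} [MeasurableSpace 𝒳] [MeasurableSpace 𝒱]
    [MeasurableSpace Θ] (n₁ m₁ n₂ m₂ : ℕ) (P Q : Measure (𝒳 × 𝒱)) [IsProbabilityMeasure P]
    [IsProbabilityMeasure Q] {f : Θ → 𝒳 → ℝ} {gX gY : Θ → 𝒱 → ℝ}
    (hf : Measurable (Function.uncurry f)) (hgX : Measurable (Function.uncurry gX))
    (hgY : Measurable (Function.uncurry gY)) {ν : Measure Θ}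
    (hgXf : ∀ᵐ t ∂ν, IsCondMean P (f t) (gX t)) (hgYf : ∀ᵐ t ∂ν, IsCondMean Q (f t) (gY t)) :
    AEMeasurable (fun t => standardizedShift n₁ m₁ n₂ m₂ P Q (f t)) ν := by
  unfold standardizedShift
  exact ((measurable_popMean P hf).sub (measurable_popMean Q hf)).aemeasurable.div
    ((aemeasurable_sigmaSq n₁ m₁ P hf hgX hgXf).add
      (aemeasurable_sigmaSq n₂ m₂ Q hf hgY hgYf)).sqrt

section Power

variable {𝒳 𝒱 : Type*} [MeasurableSpace 𝒳] [MeasurableSpace 𝒱]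
    {Ω Θ : ℕ → Type*} [∀ k, MeasurableSpace (Ω k)] [∀ k, MeasurableSpace (Θ k)]
    {μ : ∀ k, Measure (Ω k)}
    {P Q : ℕ → Measure (𝒳 × 𝒱)} [∀ k, IsProbabilityMeasure (P k)]
    [∀ k, IsProbabilityMeasure (Q k)]
    {n₁ m₁ n₂ m₂ : ℕ → ℕ} {ξ : ∀ k, Ω k → Θ k} {f : ∀ k, Θ k → 𝒳 → ℝ}
    {gX gY : ∀ k, Θ k → 𝒱 → ℝ}
    {LX : ∀ k, Ω k → Fin (n₁ k) → 𝒳 × 𝒱} {UV : ∀ k, Ω k → Fin (m₁ k) → 𝒱}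
    {LY : ∀ k, Ω k → Fin (n₂ k) → 𝒳 × 𝒱} {UW : ∀ k, Ω k → Fin (m₂ k) → 𝒱} {δ : ℝ}

/-- Off an event of small probability, the feature satisfies the moment condition, and the
conditional normal approximation applies to it. -/
lemma eventually_conditional_approx (m₁ m₂ : ℕ → ℕ)
    (hn : Tendsto (fun k => min (n₁ k) (n₂ k)) atTop atTop)
    (hξ : ∀ k, AEMeasurable (ξ k) (μ k))
    (hf : ∀ k, Measurable (Function.uncurry (f k)))
    (hgX : ∀ k, Measurable (Function.uncurry (gX k)))
    (hgY : ∀ k, Measurable (Function.uncurry (gY k)))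
    (hgXf : ∀ k, ∀ᵐ t ∂((μ k).map (ξ k)), IsCondMean (P k) (f k t) (gX k t))
    (hgYf : ∀ k, ∀ᵐ t ∂((μ k).map (ξ k)), IsCondMean (Q k) (f k t) (gY k t))
    (hδ : 0 < δ)
    (hX : IsLittleOP μ (fun k ω => momentRatio δ (P k) (f k (ξ k ω)))
      (fun k => (n₁ k : ℝ) ^ (δ / 2)))
    (hY : IsLittleOP μ (fun k ω => momentRatio δ (Q k) (f k (ξ k ω)))
      (fun k => (n₂ k : ℝ) ^ (δ / 2))) (z : ℝ) {η : ℝ} (hη : 0 < η) :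
    ∃ ε > 0, ∀ᶠ k in atTop, ∃ B : Set (Ω k), μ k B ≤ ENNReal.ofReal η ∧
      ∀ᵐ ω ∂(μ k), ω ∉ B →
      0 < sigmaSq (n₁ k) (m₁ k) (P k) (f k (ξ k ω)) + sigmaSq (n₂ k) (m₂ k) (Q k) (f k (ξ k ω)) ∧
      ∀ c, |c - z| ≤ ε →
        |((oneSampleLaw (P k) (n₁ k) (m₁ k)).prod (oneSampleLaw (Q k) (n₂ k) (m₂ k))).real
            {d | c < oracleStat (f k (ξ k ω)) (gX k (ξ k ω)) (gY k (ξ k ω))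
              d.1.1 d.1.2 d.2.1 d.2.2}
          - normalCDF (standardizedShift (n₁ k) (m₁ k) (n₂ k) (m₂ k) (P k) (Q k) (f k (ξ k ω))
              - z)| ≤ η ∧
        |((oneSampleLaw (P k) (n₁ k) 0).prod (oneSampleLaw (Q k) (n₂ k) 0)).real
            {d | c < tStat (f k (ξ k ω)) d.1.1 d.2.1}
          - normalCDF (standardizedShift (n₁ k) 0 (n₂ k) 0 (P k) (Q k) (f k (ξ k ω)) - z)|
            ≤ η := by
  obtain ⟨ε, hε, hev⟩ := exists_conditional_power_approx (𝒳 := 𝒳) (𝒱 := 𝒱) hδ hη z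
  refine ⟨ε, hε, ?_⟩
  have hη2 : (0 : ℝ≥0∞) < ENNReal.ofReal (η / 2) := ENNReal.ofReal_pos.2 (by positivity)
  filter_upwards [hn.eventually hev, (hX ε hε).eventually_le_const hη2,
    (hY ε hε).eventually_le_const hη2] with k hk hBX hBY
  refine ⟨_, (measure_union_le _ _).trans ((add_le_add hBX hBY).trans_eq ?_), ?_⟩
  · rw [← ENNReal.ofReal_add (by positivity) (by positivity), add_halves]
  · filter_upwards [ae_of_ae_map (hξ k) (hgXf k), ae_of_ae_map (hξ k) (hgYf k)] with ω hcX hcY hω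
    rw [Set.mem_union, not_or] at hω
    exact hk (n₁ k) (m₁ k) (n₂ k) (m₂ k) (min_le_left _ _) (min_le_right _ _) (P k) (Q k)
      (f k (ξ k ω)) (gX k (ξ k ω)) (gY k (ξ k ω)) ((hf k).comp measurable_prodMk_left)
      ((hgX k).comp measurable_prodMk_left) ((hgY k).comp measurable_prodMk_left) hcX hcY
      (not_le.1 hω.1) (not_le.1 hω.2)

lemma aestronglyMeasurable_limitPower (m₁ m₂ : ℕ → ℕ) (hξ : ∀ k, AEMeasurable (ξ k) (μ k))
    (hf : ∀ k, Measurable (Function.uncurry (f k)))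
    (hgX : ∀ k, Measurable (Function.uncurry (gX k)))
    (hgY : ∀ k, Measurable (Function.uncurry (gY k)))
    (hgXf : ∀ k, ∀ᵐ t ∂((μ k).map (ξ k)), IsCondMean (P k) (f k t) (gX k t))
    (hgYf : ∀ k, ∀ᵐ t ∂((μ k).map (ξ k)), IsCondMean (Q k) (f k t) (gY k t)) (z : ℝ) (k : ℕ) :
    AEStronglyMeasurable (fun ω => normalCDF (standardizedShift (n₁ k) (m₁ k) (n₂ k) (m₂ k)
      (P k) (Q k) (f k (ξ k ω)) - z)) (μ k) := by
  have h := aemeasurable_standardizedShift (n₁ k) (m₁ k) (n₂ k) (m₂ k) (P k) (Q k) (hf k) (hgX k)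
    (hgY k) (hgXf k) (hgYf k)
  exact (measurable_normalCDF.comp_aemeasurable
    ((h.comp_aemeasurable (hξ k)).sub_const z)).aestronglyMeasurable

variable [∀ k, IsProbabilityMeasure (μ k)]

lemma tendsto_oraclePower_sub
    (hn : Tendsto (fun k => min (n₁ k) (n₂ k)) atTop atTop)
    (hf : ∀ k, Measurable (Function.uncurry (f k)))
    (hgX : ∀ k, Measurable (Function.uncurry (gX k)))
    (hgY : ∀ k, Measurable (Function.uncurry (gY k)))
    (hgXf : ∀ k, ∀ᵐ t ∂((μ k).map (ξ k)), IsCondMean (P k) (f k t) (gX k t))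
    (hgYf : ∀ k, ∀ᵐ t ∂((μ k).map (ξ k)), IsCondMean (Q k) (f k t) (gY k t))
    (hsample : ∀ k,
      IsSemiSupervisedSample (μ k) (P k) (Q k) (ξ k) (LX k) (UV k) (LY k) (UW k))
    (hδ : 0 < δ)
    (hX : IsLittleOP μ (fun k ω => momentRatio δ (P k) (f k (ξ k ω)))
      (fun k => (n₁ k : ℝ) ^ (δ / 2)))
    (hY : IsLittleOP μ (fun k ω => momentRatio δ (Q k) (f k (ξ k ω)))
      (fun k => (n₂ k : ℝ) ^ (δ / 2))) (α : ℝ) :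
    Tendsto (fun k =>
        oraclePower (μ k) α (ξ k) (f k) (gX k) (gY k) (LX k) (UV k) (LY k) (UW k) -
          ∫ ω, normalCDF (standardizedShift (n₁ k) (m₁ k) (n₂ k) (m₂ k) (P k) (Q k) (f k (ξ k ω))
            - normalQuantile (1 - α)) ∂(μ k))
      atTop (𝓝 0) := by
  have hξ : ∀ k, AEMeasurable (ξ k) (μ k) := fun k => (hsample k).aemeasurable.fst
  refine tendsto_measureReal_sub_integral μ ξ (fun k ω => ((LX k ω, UV k ω), (LY k ω, UW k ω)))
    (fun k => (oneSampleLaw (P k) (n₁ k) (m₁ k)).prod (oneSampleLaw (Q k) (n₂ k) (m₂ k)))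
    hsample (fun k => {q | normalQuantile (1 - α) <
      oracleStat (f k q.1) (gX k q.1) (gY k q.1) q.2.1.1 q.2.1.2 q.2.2.1 q.2.2.2})
    (fun k => measurableSet_lt measurable_const (measurable_oracleStat (hf k) (hgX k) (hgY k)))
    _ (aestronglyMeasurable_limitPower m₁ m₂ hξ hf hgX hgY hgXf hgYf _)
    (fun k ω => normalCDF_nonneg _) (fun k ω => normalCDF_le_one _) fun η hη => ?_
  obtain ⟨ε, hε, hev⟩ := eventually_conditional_approx m₁ m₂ hn hξ hf hgX hgY hgXf hgYf hδ hX hY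
    (normalQuantile (1 - α)) hη
  filter_upwards [hev] with k ⟨B, hB, hae⟩
  refine ⟨B, hB, ?_⟩
  filter_upwards [hae] with ω hω hωB
  exact ((hω hωB).2 _ (by simpa using hε.le)).1

lemma tendsto_tPower_sub
    (hn : Tendsto (fun k => min (n₁ k) (n₂ k)) atTop atTop)
    (hf : ∀ k, Measurable (Function.uncurry (f k)))
    (hgX : ∀ k, Measurable (Function.uncurry (gX k)))
    (hgY : ∀ k, Measurable (Function.uncurry (gY k)))
    (hgXf : ∀ k, ∀ᵐ t ∂((μ k).map (ξ k)), IsCondMean (P k) (f k t) (gX k t))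
    (hgYf : ∀ k, ∀ᵐ t ∂((μ k).map (ξ k)), IsCondMean (Q k) (f k t) (gY k t))
    (hsample : ∀ k,
      IsSemiSupervisedSample (μ k) (P k) (Q k) (ξ k) (LX k) (UV k) (LY k) (UW k))
    (hδ : 0 < δ)
    (hX : IsLittleOP μ (fun k ω => momentRatio δ (P k) (f k (ξ k ω)))
      (fun k => (n₁ k : ℝ) ^ (δ / 2)))
    (hY : IsLittleOP μ (fun k ω => momentRatio δ (Q k) (f k (ξ k ω)))
      (fun k => (n₂ k : ℝ) ^ (δ / 2))) {z : ℝ} {c : ℕ → ℝ} (hc : Tendsto c atTop (𝓝 z)) :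
    Tendsto (fun k => tPower (μ k) (c k) (ξ k) (f k) (LX k) (LY k) -
        ∫ ω, normalCDF (standardizedShift (n₁ k) 0 (n₂ k) 0 (P k) (Q k) (f k (ξ k ω)) - z) ∂(μ k))
      atTop (𝓝 0) := by
  have hξ : ∀ k, AEMeasurable (ξ k) (μ k) := fun k => (hsample k).aemeasurable.fst
  refine tendsto_measureReal_sub_integral μ ξ
    (fun k ω => ((LX k ω, (Fin.elim0 : Fin 0 → 𝒱)), (LY k ω, (Fin.elim0 : Fin 0 → 𝒱))))
    (fun k => (oneSampleLaw (P k) (n₁ k) 0).prod (oneSampleLaw (Q k) (n₂ k) 0))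
    (fun k => (hsample k).drop_unlabeled)
    (fun k => {q | c k < tStat (f k q.1) q.2.1.1 q.2.2.1})
    (fun k => measurableSet_lt measurable_const (measurable_tStat (hf k)))
    _ (aestronglyMeasurable_limitPower (fun _ => 0) (fun _ => 0) hξ hf hgX hgY hgXf hgYf _)
    (fun k ω => normalCDF_nonneg _) (fun k ω => normalCDF_le_one _) fun η hη => ?_
  obtain ⟨ε, hε, hev⟩ := eventually_conditional_approx (fun _ => 0) (fun _ => 0) hn hξ hf hgX hgY
    hgXf hgYf hδ hX hY z hη
  filter_upwards [hev, Metric.tendsto_nhds.1 hc ε hε] with k ⟨B, hB, hae⟩ hck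
  refine ⟨B, hB, ?_⟩
  filter_upwards [hae] with ω hω hωB
  exact ((hω hωB).2 (c k) (by rw [← Real.dist_eq]; exact hck.le)).2

/-- In the direction of the alternative, the limiting power of the test with unlabeled data
dominates the one without. -/
lemma eventually_integral_limitPower_zero_le
    (hn : Tendsto (fun k => min (n₁ k) (n₂ k)) atTop atTop)
    (hξ : ∀ k, AEMeasurable (ξ k) (μ k))
    (hf : ∀ k, Measurable (Function.uncurry (f k)))
    (hgX : ∀ k, Measurable (Function.uncurry (gX k)))
    (hgY : ∀ k, Measurable (Function.uncurry (gY k)))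
    (hgXf : ∀ k, ∀ᵐ t ∂((μ k).map (ξ k)), IsCondMean (P k) (f k t) (gX k t))
    (hgYf : ∀ k, ∀ᵐ t ∂((μ k).map (ξ k)), IsCondMean (Q k) (f k t) (gY k t))
    (hδ : 0 < δ)
    (hX : IsLittleOP μ (fun k ω => momentRatio δ (P k) (f k (ξ k ω)))
      (fun k => (n₁ k : ℝ) ^ (δ / 2)))
    (hY : IsLittleOP μ (fun k ω => momentRatio δ (Q k) (f k (ξ k ω)))
      (fun k => (n₂ k : ℝ) ^ (δ / 2)))
    (halt : Tendsto (fun k => μ k {ω | popMean (P k) (f k (ξ k ω)) < popMean (Q k) (f k (ξ k ω))})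
        atTop (𝓝 0)) (m₁ m₂ : ℕ → ℕ) (z : ℝ) {η : ℝ} (hη : 0 < η) :
    ∀ᶠ k in atTop,
      ∫ ω, normalCDF (standardizedShift (n₁ k) 0 (n₂ k) 0 (P k) (Q k) (f k (ξ k ω)) - z) ∂(μ k)
        ≤ ∫ ω, normalCDF (standardizedShift (n₁ k) (m₁ k) (n₂ k) (m₂ k) (P k) (Q k) (f k (ξ k ω))
            - z) ∂(μ k) + η := by
  have hη2 : 0 < η / 2 := by positivity
  obtain ⟨ε, hε, hev⟩ := eventually_conditional_approx m₁ m₂ hn hξ hf hgX hgY hgXf hgYf hδ hX hY z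
    hη2
  filter_upwards [hev, halt.eventually_le_const (ENNReal.ofReal_pos.2 hη2),
    hn.eventually_ge_atTop 1] with k ⟨B, hB, hae⟩ hk hnk
  set A : Set (Ω k) := {ω | popMean (P k) (f k (ξ k ω)) < popMean (Q k) (f k (ξ k ω))} with hA
  have key := integral_sub_integral_le
    (aestronglyMeasurable_limitPower (n₁ := n₁) (n₂ := n₂) (fun _ => 0) (fun _ => 0) hξ hf hgX hgY
      hgXf hgYf z k)
    (aestronglyMeasurable_limitPower (n₁ := n₁) (n₂ := n₂) m₁ m₂ hξ hf hgX hgY hgXf hgYf z k)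
    (fun ω => normalCDF_nonneg _) (fun ω => normalCDF_le_one _)
    (fun ω => normalCDF_nonneg _) (fun ω => normalCDF_le_one _) (B := B ∪ A) (by
      filter_upwards [hae] with ω hω hωB
      rw [Set.mem_union, not_or] at hωB
      refine normalCDF_mono (sub_le_sub_right ?_ z)
      exact standardizedShift_zero_le (lt_of_lt_of_le one_pos (hnk.trans (min_le_left _ _)))
        (lt_of_lt_of_le one_pos (hnk.trans (min_le_right _ _))) (hω hωB.1).1 (not_lt.1 hωB.2))
  have hBA : (μ k).real (B ∪ A) ≤ η := by
    refine ENNReal.toReal_le_of_le_ofReal hη.le ((measure_union_le _ _).trans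
      ((add_le_add hB hk).trans_eq ?_))
    rw [← ENNReal.ofReal_add hη2.le hη2.le, add_halves]
  linarith

end Power

end SemiSupervised

theorem theorem1 {𝒳 𝒱 : Type*} [MeasurableSpace 𝒳] [MeasurableSpace 𝒱]
    {Ω Θ : ℕ → Type*} [∀ k, MeasurableSpace (Ω k)] [∀ k, MeasurableSpace (Θ k)]
    -- the underlying probability spaces and the laws of `(X, V)` and `(Y, W)`
    (μ : ∀ k, Measure (Ω k)) [∀ k, IsProbabilityMeasure (μ k)]
    (P Q : ℕ → Measure (𝒳 × 𝒱)) [∀ k, IsProbabilityMeasure (P k)]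
    [∀ k, IsProbabilityMeasure (Q k)]
    -- sample sizes, with no restriction on `m₁` and `m₂`
    (n₁ m₁ n₂ m₂ : ℕ → ℕ) (hn : Tendsto (fun k => min (n₁ k) (n₂ k)) atTop atTop)
    -- the random feature `f k (ξ k ω) : 𝒳 → ℝ` and the known conditional means
    (ξ : ∀ k, Ω k → Θ k) (f : ∀ k, Θ k → 𝒳 → ℝ)
    (hf : ∀ k, Measurable (Function.uncurry (f k)))
    (gX gY : ∀ k, Θ k → 𝒱 → ℝ)
    (hgX : ∀ k, Measurable (Function.uncurry (gX k)))
    (hgY : ∀ k, Measurable (Function.uncurry (gY k)))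
    (hgXf : ∀ k, ∀ᵐ t ∂((μ k).map (ξ k)), IsCondMean (P k) (f k t) (gX k t))
    (hgYf : ∀ k, ∀ᵐ t ∂((μ k).map (ξ k)), IsCondMean (Q k) (f k t) (gY k t))
    -- labeled and unlabeled data
    (LX : ∀ k, Ω k → Fin (n₁ k) → 𝒳 × 𝒱) (UV : ∀ k, Ω k → Fin (m₁ k) → 𝒱)
    (LY : ∀ k, Ω k → Fin (n₂ k) → 𝒳 × 𝒱) (UW : ∀ k, Ω k → Fin (m₂ k) → 𝒱)
    (hsample : ∀ k,
      IsSemiSupervisedSample (μ k) (P k) (Q k) (ξ k) (LX k) (UV k) (LY k) (UW k))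
    -- the moment condition, conditionally on the feature
    (δ : ℝ) (hδ : 0 < δ)
    (hX : IsLittleOP μ (fun k ω => momentRatio δ (P k) (f k (ξ k ω)))
      (fun k => (n₁ k : ℝ) ^ (δ / 2)))
    (hY : IsLittleOP μ (fun k ω => momentRatio δ (Q k) (f k (ξ k ω)))
      (fun k => (n₂ k : ℝ) ^ (δ / 2)))
    (α : ℝ) (hα : α ∈ Set.Ioo (0 : ℝ) 1) :
    -- asymptotic power, unconditionally on the feature
    Tendsto (fun k =>
        oraclePower (μ k) α (ξ k) (f k) (gX k) (gY k) (LX k) (UV k) (LY k) (UW k) -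
          ∫ ω, normalCDF (normalQuantile α +
            standardizedShift (n₁ k) (m₁ k) (n₂ k) (m₂ k) (P k) (Q k) (f k (ξ k ω))) ∂(μ k))
      atTop (𝓝 0) ∧
    -- asymptotic size under the null hypothesis `P_X = P_Y`
    ((∀ k, (P k).fst = (Q k).fst) →
      Tendsto (fun k =>
          oraclePower (μ k) α (ξ k) (f k) (gX k) (gY k) (LX k) (UV k) (LY k) (UW k))
        atTop (𝓝 α)) ∧
    -- comparison with tests that ignore the unlabeled data, in the direction of the alternative
    (Tendsto (fun k => μ k {ω | popMean (P k) (f k (ξ k ω)) < popMean (Q k) (f k (ξ k ω))})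
        atTop (𝓝 0) →
      -- the two-sample `t`-test, with any critical values tending to the normal quantile
      (∀ c : ℕ → ℝ, Tendsto c atTop (𝓝 (normalQuantile (1 - α))) →
        ∀ ε : ℝ, 0 < ε → ∀ᶠ k in atTop,
          tPower (μ k) (c k) (ξ k) (f k) (LX k) (LY k) - ε ≤
            oraclePower (μ k) α (ξ k) (f k) (gX k) (gY k) (LX k) (UV k) (LY k) (UW k)) ∧
      -- the oracle test with `m₁ = m₂ = 0`
      (∀ ε : ℝ, 0 < ε → ∀ᶠ k in atTop,
        oraclePower (m₁ := 0) (m₂ := 0) (μ k) α (ξ k) (f k) (gX k) (gY k)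
            (LX k) (fun _ => Fin.elim0) (LY k) (fun _ => Fin.elim0) - ε ≤
          oraclePower (μ k) α (ξ k) (f k) (gX k) (gY k) (LX k) (UV k) (LY k) (UW k))) := by
  have hξ : ∀ k, AEMeasurable (ξ k) (μ k) := fun k => (hsample k).aemeasurable.fst
  have hz := normalQuantile_one_sub hα
  have hpow := tendsto_oraclePower_sub hn hf hgX hgY hgXf hgYf hsample hδ hX hY α
  refine ⟨?_, fun hPQ => ?_, fun halt => ⟨fun c hc ε hε => ?_, fun ε hε => ?_⟩⟩
  · simpa only [hz, sub_neg_eq_add, add_comm (normalQuantile α)] using hpow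
  · have hmean : ∀ k ω, popMean (P k) (f k (ξ k ω)) = popMean (Q k) (f k (ξ k ω)) := fun k ω => by
      have hm : AEStronglyMeasurable (f k (ξ k ω)) (P k).fst :=
        ((hf k).comp measurable_prodMk_left).aestronglyMeasurable
      have hm' : AEStronglyMeasurable (f k (ξ k ω)) (Q k).fst := hPQ k ▸ hm
      have h1 := integral_map measurable_fst.aemeasurable hm
      have h2 := integral_map measurable_fst.aemeasurable hm'
      exact h1.symm.trans ((congrArg (fun ν => ∫ x, f k (ξ k ω) x ∂ν) (hPQ k)).trans h2)
    have hint : ∀ k, ∫ ω, normalCDF (standardizedShift (n₁ k) (m₁ k) (n₂ k) (m₂ k) (P k) (Q k)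
        (f k (ξ k ω)) - normalQuantile (1 - α)) ∂(μ k) = α := fun k => by
      simp only [standardizedShift, hmean, sub_self, zero_div, zero_sub, hz, neg_neg,
        normalCDF_normalQuantile hα]
      simp
    simp only [hint] at hpow
    simpa using hpow.add_const α
  · have ht := tendsto_tPower_sub hn hf hgX hgY hgXf hgYf hsample hδ hX hY hc
    filter_upwards [Metric.tendsto_nhds.1 hpow (ε / 3) (by positivity),
      Metric.tendsto_nhds.1 ht (ε / 3) (by positivity),
      eventually_integral_limitPower_zero_le hn hξ hf hgX hgY hgXf hgYf hδ hX hY halt m₁ m₂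
        (normalQuantile (1 - α)) (by positivity : 0 < ε / 3)] with k h1 h2 h3
    rw [Real.dist_eq, sub_zero, abs_lt] at h1 h2
    linarith [h1.1, h2.2]
  · have h0 := tendsto_oraclePower_sub (m₁ := fun _ => 0) (m₂ := fun _ => 0) hn hf hgX hgY hgXf hgYf
      (fun k => (hsample k).drop_unlabeled) hδ hX hY α
    filter_upwards [Metric.tendsto_nhds.1 hpow (ε / 3) (by positivity),
      Metric.tendsto_nhds.1 h0 (ε / 3) (by positivity),
      eventually_integral_limitPower_zero_le hn hξ hf hgX hgY hgXf hgYf hδ hX hY halt m₁ m₂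
        (normalQuantile (1 - α)) (by positivity : 0 < ε / 3)] with k h1 h2 h3
    rw [Real.dist_eq, sub_zero, abs_lt] at h1 h2
    linarith [h1.1, h2.2]
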